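/- A graph $G$ with vertex set partitioned as $V(G)=H\cup C$ is a *small crowned graph* with head $H$ and crown $C$ if $C$ is an independent set, $|H|=|C|$, and $G$ has a matching $M$ between $H$ and $C$ with $|M|=|H|$. In the problem Enum Small Crown, the input is a small crowned graph $G=(H\cup C,E)$ (a finite simple graph together with its head $H$; the matching is not part of the input) and the task is to list, each exactly once, all vertex covers of $G$ of size exactly $|H|$. There is a polynomial-delay algorithm for Enum Small Crown. That is, there are an algorithm (one program for a unit-cost random access machine whose only arithmetic instructions are increment and decrement, the same for all inputs) and a polynomial $p$ such that, on every small crowned graph $G=(H\cup C,E)$, given by $|V(G)|$, the characteristic vector of $H$ and the adjacency matrix of $G$, the algorithm outputs every vertex cover of $G$ of size exactly $|H|$ exactly once (as a characteristic vector), outputs nothing else, and halts; and the time before the first output, the time between any two consecutive outputs, and the time after the last output until halting are all at most $p(|V(G)|+|E(G)|)$. -/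

import Mathlib

/-! ### Random access machines with an output channel

The machine model is the unit-cost successor random access machine with structured control.
A machine has registers `r 0, r 1, …` and arrays `a 0, a 1, …`, all holding natural numbers
(a program mentions only finitely many registers and arrays).  Every step is one constant-size
operation: load a constant, copy, increment, decrement, read or write an array cell addressed by
a register, compare two registers and branch, print a number, or close the word printed so far
and deliver it as the next output.  There are no arithmetic instructions besides increment and
decrement, so after `t` steps every stored number is at most `t` plus the largest number in the
program and in the input (its length included), and unit cost is an honest measure of time. -/

namespace EnumRAM

/-- Programs. -/
inductive Prog : Type
  /-- `r x := c` -/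
  | const (x c : ℕ)
  /-- `r x := r y` -/
  | copy (x y : ℕ)
  /-- `r x := r x + 1` -/
  | inc (x : ℕ)
  /-- `r x := r x - 1` (and `0` stays `0`) -/
  | dec (x : ℕ)
  /-- `r x := a k [r y]` -/
  | load (x k y : ℕ)
  /-- `a k [r x] := r y` -/
  | store (k x y : ℕ)
  /-- append the number `r x` to the word being printed -/
  | print (x : ℕ)
  /-- deliver the word printed since the last delivery as the next output -/
  | emit
  /-- do nothing -/
  | skip
  /-- first `p`, then `q` -/
  | seq (p q : Prog)
  /-- `if r x < r y then p else q` -/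
  | ifLt (x y : ℕ) (p q : Prog)
  /-- `while r x < r y do p` -/
  | whileLt (x y : ℕ) (p : Prog)

/-- Configurations of the machine. -/
structure Cfg where
  /-- what is left to be executed: a stack of subprograms of the program, whose height is at most
  one more than the nesting depth of the program -/
  todo : List Prog
  /-- the registers -/
  reg : ℕ → ℕ
  /-- the arrays -/
  arr : ℕ → ℕ → ℕ
  /-- the word that is being printed -/
  buf : List ℕ
  /-- the words that have been output so far, in order -/
  out : List (List ℕ)

/-- One step of the machine.  A machine with nothing left to execute has halted. -/
def step (c : Cfg) : Cfg :=
  match c.todo with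
  | [] => c
  | .const x n :: k => { c with todo := k, reg := Function.update c.reg x n }
  | .copy x y :: k => { c with todo := k, reg := Function.update c.reg x (c.reg y) }
  | .inc x :: k => { c with todo := k, reg := Function.update c.reg x (c.reg x + 1) }
  | .dec x :: k => { c with todo := k, reg := Function.update c.reg x (c.reg x - 1) }
  | .load x i y :: k => { c with todo := k, reg := Function.update c.reg x (c.arr i (c.reg y)) }
  | .store i x y :: k =>
      { c with
        todo := k
        arr := Function.update c.arr i (Function.update (c.arr i) (c.reg x) (c.reg y)) }
  | .print x :: k => { c with todo := k, buf := c.buf ++ [c.reg x] }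
  | .emit :: k => { c with todo := k, buf := [], out := c.out ++ [c.buf] }
  | .skip :: k => { c with todo := k }
  | .seq p q :: k => { c with todo := p :: q :: k }
  | .ifLt x y p q :: k => { c with todo := (if c.reg x < c.reg y then p else q) :: k }
  | .whileLt x y p :: k =>
      { c with todo := if c.reg x < c.reg y then p :: .whileLt x y p :: k else k }

/-- The initial configuration on the input word `w`: the length of `w` is in register `0`, the
letters of `w` are in array `0`, and everything else is `0`. -/
def init (P : Prog) (w : List ℕ) : Cfg where
  todo := [P]
  reg := Function.update (fun _ => 0) 0 w.length
  arr := Function.update (fun _ _ => 0) 0 (fun i => w.getD i 0)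
  buf := []
  out := []

/-- The configuration after `t` steps on the input word `w`. -/
def run (P : Prog) (w : List ℕ) (t : ℕ) : Cfg := step^[t] (init P w)

/-- The machine has halted. -/
def Cfg.Halted (c : Cfg) : Prop := c.todo = []

/-- On the input word `w` the program `P` halts after having output every word of `L` exactly once
and no other word. -/
def Enumerates (P : Prog) (w : List ℕ) (L : Set (List ℕ)) : Prop :=
  ∃ T, (run P w T).Halted ∧ (run P w T).out.Nodup ∧ ∀ u, u ∈ (run P w T).out ↔ u ∈ L

/-- On the input word `w` the program `P` has delay at most `d`: from the start, and from every
later moment on, it takes at most `d` steps until the next output is delivered or the machine has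
halted.  So `d` bounds the time before the first output, the time between any two consecutive
outputs, and the time from the last output until the machine halts. -/
def HasDelay (P : Prog) (w : List ℕ) (d : ℕ) : Prop :=
  ∀ t, (run P w t).out.length < (run P w (t + d)).out.length ∨ (run P w (t + d)).Halted

/-- An enumeration problem has a class `ι` of instances, each with a `size` and an encoding `enc`
as an input word, and a set `sol i` of encoded solutions for every instance `i`.  It admits a
polynomial-delay algorithm if one program enumerates, for every instance, all solutions without
repetition and with delay bounded by a polynomial in the size. -/
def AdmitsPolynomialDelay {ι : Type} (size : ι → ℕ) (enc : ι → List ℕ)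
    (sol : ι → Set (List ℕ)) : Prop :=
  ∃ (P : Prog) (p : Polynomial ℕ), ∀ i : ι,
    Enumerates P (enc i) (sol i) ∧ HasDelay P (enc i) (p.eval (size i))

end EnumRAM

/-! ### Crowned graphs -/

/-- `G` is a crowned graph with head `H` and crown `C = Hᶜ`: the crown is independent and there is
a matching `M` between `H` and `C` with `|M| = |H|`. -/
def IsCrownedGraph {V : Type*} [Fintype V] [DecidableEq V] (G : SimpleGraph V)
    (H : Finset V) : Prop :=
  G.IsIndepSet (Hᶜ : Finset V) ∧
    ∃ M : G.Subgraph, M.IsMatching ∧ (∀ u v, M.Adj u v → (u ∈ H ↔ v ∈ Hᶜ)) ∧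
      M.edgeSet.ncard = H.card

/-- A small crowned graph: a crowned graph whose head and crown have the same size. -/
def IsSmallCrownedGraph {V : Type*} [Fintype V] [DecidableEq V] (G : SimpleGraph V)
    (H : Finset V) : Prop :=
  IsCrownedGraph G H ∧ (Hᶜ).card = H.card

/-- Instances of the problem: small crowned graphs given by the graph and its head.  (The matching
is not a part of the instance.) -/
structure SmallCrown : Type where
  /-- the number of vertices -/
  n : ℕ
  /-- the graph -/
  G : SimpleGraph (Fin n)
  /-- the head -/
  H : Finset (Fin n)
  isSmallCrowned : IsSmallCrownedGraph G H

namespace SmallCrown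

/-- The solutions: the vertex covers of `G` of size exactly `|H|`. -/
def Sol (I : SmallCrown) : Set (Finset (Fin I.n)) :=
  {S | I.G.IsVertexCover (S : Set (Fin I.n)) ∧ S.card = I.H.card}

/-- The size `|V(G)| + |E(G)|` of an instance. -/
noncomputable def size (I : SmallCrown) : ℕ := I.n + I.G.edgeSet.ncard

/-- The characteristic word of a set of vertices. -/
def charWord {n : ℕ} (S : Finset (Fin n)) : List ℕ :=
  List.ofFn fun v => if v ∈ S then 1 else 0

open Classical in
/-- The input word of an instance: the number of vertices, the characteristic word of the head, and
the rows of the adjacency matrix. -/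
noncomputable def encode (I : SmallCrown) : List ℕ :=
  I.n :: (charWord I.H ++
    (List.ofFn fun u => List.ofFn fun v => if I.G.Adj u v then 1 else 0).flatten)

end SmallCrown

/-! Fix a perfect matching between head and crown. A cover of size |H| contains exactly one end of
every matching edge, so it is determined by the set A ⊆ H of head vertices that it omits: it is H \
A together with the mates of A. Since the crown is independent, this set is a cover exactly when A
is independent and closed under the relation u → v, meaning that u is adjacent to the mate of v
(`IsMate.coverOf_isCover`, `IsMate.exists_coverOf_eq`). The task becomes the enumeration of the
closed independent subsets of H.

These sets are listed in colexicographic order, starting from ∅. If D comes after A and i is the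
largest element where they differ, then D contains i and the part of A above i, hence also the
closure B of these. So B is independent and adds nothing above i, and this can be tested at each i
in H \ A. Closures are least, so the smallest i passing the test yields the immediate successor of
A, and if no i passes then A is the last set (`exists_admissible`, `Admissible.le`). Each successor
costs polynomial time, and no list of earlier outputs is needed to avoid repetitions.

The matching has to be computed from the input. An auction does it: an unmatched head vertex takes
its cheapest neighbour in the crown, displaces the previous owner and raises the price by one. Free
crown vertices cost 0, and every matched head vertex pays at most one more than the cheapest of its
neighbours. With a Hall type count this keeps some neighbour of an unmatched head vertex at a price
below n (`Auction.exists_price_lt`), so prices stay at most n. Every bid raises the total price,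
which is below n² if H is nonempty, so n² sweeps over the vertices suffice.

On the machine side, everything but the outermost loop is written with for-loops of length n. Such
commands have a total semantics, proved correct by loop invariants, and a polynomial time bound read
off from the syntax (`compile_run`). The outermost loop delivers one word per round, which turns the
time bound into a delay bound (`progress_of_checkpoints`). -/

namespace EnumRAM

/-! ### A total language of counting loops on top of the machine -/

/-- The data part of a configuration. -/
structure St where
  /-- the registers -/
  reg : ℕ → ℕ
  /-- the arrays -/
  arr : ℕ → ℕ → ℕ
  /-- the word that is being printed -/
  buf : List ℕ
  /-- the words that have been output so far -/
  out : List (List ℕ)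

/-- The configuration with data `s` and remaining program stack `k`. -/
def St.cfg (s : St) (k : List Prog) : Cfg := ⟨k, s.reg, s.arr, s.buf, s.out⟩

/-- Overwrite a register. -/
def St.set (s : St) (x v : ℕ) : St := { s with reg := Function.update s.reg x v }

@[simp] theorem St.set_reg (s : St) (x v r : ℕ) :
    (s.set x v).reg r = if r = x then v else s.reg r := by
  simp [St.set, Function.update_apply]

@[simp] theorem St.set_arr (s : St) (x v : ℕ) : (s.set x v).arr = s.arr := rfl
@[simp] theorem St.set_buf (s : St) (x v : ℕ) : (s.set x v).buf = s.buf := rfl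
@[simp] theorem St.set_out (s : St) (x v : ℕ) : (s.set x v).out = s.out := rfl

/-- Overwrite an array cell. -/
def St.put (s : St) (k i v : ℕ) : St :=
  { s with arr := Function.update s.arr k (Function.update (s.arr k) i v) }

@[simp] theorem St.put_reg (s : St) (k i v : ℕ) : (s.put k i v).reg = s.reg := rfl
@[simp] theorem St.put_buf (s : St) (k i v : ℕ) : (s.put k i v).buf = s.buf := rfl
@[simp] theorem St.put_out (s : St) (k i v : ℕ) : (s.put k i v).out = s.out := rfl

@[simp] theorem St.put_arr (s : St) (k i v l : ℕ) :
    (s.put k i v).arr l = if l = k then Function.update (s.arr k) i v else s.arr l := by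
  by_cases h : l = k
  · subst h; simp [St.put]
  · simp [St.put, h]

/-- Programs all of whose loops run through `0, …, n - 1`, where `n` is held by register `1`. -/
inductive Cmd : Type
  /-- `r x := c` -/
  | const (x c : ℕ)
  /-- `r x := r y` -/
  | copy (x y : ℕ)
  /-- `r x := r x + 1` -/
  | inc (x : ℕ)
  /-- `r x := a k [r y]` -/
  | load (x k y : ℕ)
  /-- `a k [r x] := r y` -/
  | store (k x y : ℕ)
  /-- print `r x` -/
  | print (x : ℕ)
  /-- deliver the word -/
  | emit
  /-- do nothing -/
  | skip
  /-- composition -/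
  | seq (p q : Cmd)
  /-- conditional -/
  | ifLt (x y : ℕ) (p q : Cmd)
  /-- `for r x = 0, …, r 1 - 1 do p` -/
  | loop (x : ℕ) (p : Cmd)

namespace Cmd

/-- Sequential composition of a list of commands. -/
def block : List Cmd → Cmd
  | [] => skip
  | [c] => c
  | c :: d :: l => seq c (block (d :: l))

/-- The machine program of a command. -/
def compile : Cmd → Prog
  | const x c => .const x c
  | copy x y => .copy x y
  | inc x => .inc x
  | load x k y => .load x k y
  | store k x y => .store k x y
  | print x => .print x
  | emit => .emit
  | skip => .skip
  | seq p q => .seq p.compile q.compile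
  | ifLt x y p q => .ifLt x y p.compile q.compile
  | loop x p => .seq (.const x 0) (.whileLt x 1 (.seq p.compile (.inc x)))

/-- The effect of the first `m` rounds of a loop with counter `x`. -/
def rounds (f : St → St) (x : ℕ) (s : St) : ℕ → St
  | 0 => s.set x 0
  | m + 1 => (f (rounds f x s m)).set x (m + 1)

/-- The effect of a command. -/
def den : Cmd → St → St
  | const x c => fun s => s.set x c
  | copy x y => fun s => s.set x (s.reg y)
  | inc x => fun s => s.set x (s.reg x + 1)
  | load x k y => fun s => s.set x (s.arr k (s.reg y))
  | store k x y => fun s => s.put k (s.reg x) (s.reg y)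
  | print x => fun s => { s with buf := s.buf ++ [s.reg x] }
  | emit => fun s => { s with buf := [], out := s.out ++ [s.buf] }
  | skip => fun s => s
  | seq p q => fun s => q.den (p.den s)
  | ifLt x y p q => fun s => if s.reg x < s.reg y then p.den s else q.den s
  | loop x p => fun s => rounds p.den x s (s.reg 1)

/-- The registers that a command may change. -/
def regs : Cmd → List ℕ
  | const x _ => [x]
  | copy x _ => [x]
  | inc x => [x]
  | load x _ _ => [x]
  | seq p q => p.regs ++ q.regs
  | ifLt _ _ p q => p.regs ++ q.regs
  | loop x p => x :: p.regs
  | _ => []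

/-- The arrays that a command may change. -/
def arrs : Cmd → List ℕ
  | store k _ _ => [k]
  | seq p q => p.arrs ++ q.arrs
  | ifLt _ _ p q => p.arrs ++ q.arrs
  | loop _ p => p.arrs
  | _ => []

/-- The command does not print. -/
def silent : Cmd → Bool
  | print _ => false
  | emit => false
  | seq p q => p.silent && q.silent
  | ifLt _ _ p q => p.silent && q.silent
  | loop _ p => p.silent
  | _ => true

/-- The command does not deliver outputs. -/
def mute : Cmd → Bool
  | emit => false
  | seq p q => p.mute && q.mute
  | ifLt _ _ p q => p.mute && q.mute
  | loop _ p => p.mute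
  | _ => true

/-- No loop changes its own counter. -/
def counting : Cmd → Bool
  | seq p q => p.counting && q.counting
  | ifLt _ _ p q => p.counting && q.counting
  | loop x p => !p.regs.contains x && p.counting
  | _ => true

/-- Loops do not change their counters, nor the common bound of the counters. -/
def WF (c : Cmd) : Prop := c.counting = true ∧ 1 ∉ c.regs

/-- A bound for the running time. -/
noncomputable def time : Cmd → Polynomial ℕ
  | seq p q => p.time + q.time + 1
  | ifLt _ _ p q => p.time + q.time + 1
  | loop _ p => Polynomial.X * (p.time + 3) + 3
  | _ => 1

/-! ### What a command leaves unchanged, and loop invariants -/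

theorem den_reg {c : Cmd} {r : ℕ} (h : r ∉ c.regs) (s : St) : (c.den s).reg r = s.reg r := by
  induction c generalizing s with
  | seq p q hp hq =>
    simp only [regs, List.mem_append, not_or] at h
    simp [den, hp h.1, hq h.2]
  | ifLt x y p q hp hq =>
    simp only [regs, List.mem_append, not_or] at h
    simp only [den]
    split_ifs
    · exact hp h.1 s
    · exact hq h.2 s
  | loop x p hp =>
    simp only [regs, List.mem_cons, not_or] at h
    have : ∀ m, (rounds p.den x s m).reg r = s.reg r := by
      intro m
      induction m with
      | zero => simp [rounds, h.1]
      | succ m ih => simp [rounds, h.1, hp h.2, ih]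
    exact this _
  | _ => simp_all [den, regs]

theorem den_arr {c : Cmd} {k : ℕ} (h : k ∉ c.arrs) (s : St) : (c.den s).arr k = s.arr k := by
  induction c generalizing s with
  | seq p q hp hq =>
    simp only [arrs, List.mem_append, not_or] at h
    simp [den, hp h.1, hq h.2]
  | ifLt x y p q hp hq =>
    simp only [arrs, List.mem_append, not_or] at h
    simp only [den]
    split_ifs
    · exact hp h.1 s
    · exact hq h.2 s
  | loop x p hp =>
    have : ∀ m, (rounds p.den x s m).arr k = s.arr k := by
      intro m
      induction m with
      | zero => simp [rounds]
      | succ m ih => simp [rounds, hp h, ih]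
    exact this _
  | _ => simp_all [den, arrs]

theorem den_buf {c : Cmd} (h : c.silent = true) (s : St) : (c.den s).buf = s.buf := by
  induction c generalizing s with
  | seq p q hp hq =>
    simp only [silent, Bool.and_eq_true] at h
    simp [den, hp h.1, hq h.2]
  | ifLt x y p q hp hq =>
    simp only [silent, Bool.and_eq_true] at h
    simp only [den]
    split_ifs
    · exact hp h.1 s
    · exact hq h.2 s
  | loop x p hp =>
    have : ∀ m, (rounds p.den x s m).buf = s.buf := by
      intro m
      induction m with
      | zero => simp [rounds]
      | succ m ih => simp [rounds, hp h, ih]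
    exact this _
  | _ => simp_all [den, silent]

theorem den_out {c : Cmd} (h : c.mute = true) (s : St) : (c.den s).out = s.out := by
  induction c generalizing s with
  | seq p q hp hq =>
    simp only [mute, Bool.and_eq_true] at h
    simp [den, hp h.1, hq h.2]
  | ifLt x y p q hp hq =>
    simp only [mute, Bool.and_eq_true] at h
    simp only [den]
    split_ifs
    · exact hp h.1 s
    · exact hq h.2 s
  | loop x p hp =>
    have : ∀ m, (rounds p.den x s m).out = s.out := by
      intro m
      induction m with
      | zero => simp [rounds]
      | succ m ih => simp [rounds, hp h, ih]
    exact this _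
  | _ => simp_all [den, mute]

/-- The states `s` and `s'` agree on everything that `c` cannot change. -/
structure Frame (c : Cmd) (s s' : St) : Prop where
  reg : ∀ r, r ∉ c.regs → s'.reg r = s.reg r
  arr : ∀ k, k ∉ c.arrs → s'.arr k = s.arr k

theorem frame_den (c : Cmd) (s : St) : Frame c s (c.den s) :=
  ⟨fun _ h => den_reg h s, fun _ h => den_arr h s⟩

/-- The invariant rule for counting loops. -/
theorem loop_induction {x : ℕ} {p : Cmd} {s : St} (I : ℕ → St → Prop)
    (zero : I 0 (s.set x 0))
    (succ : ∀ i < s.reg 1, ∀ s', Frame (loop x p) s s' → s'.reg x = i → I i s' →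
      I (i + 1) ((p.den s').set x (i + 1))) :
    I (s.reg 1) ((loop x p).den s) := by
  have : ∀ m ≤ s.reg 1, I m (rounds p.den x s m) ∧ Frame (loop x p) s (rounds p.den x s m) ∧
      (rounds p.den x s m).reg x = m := by
    intro m
    induction m with
    | zero =>
      intro _
      refine ⟨zero, ⟨fun r hr => ?_, fun k _ => rfl⟩, by simp [rounds]⟩
      simp only [regs, List.mem_cons, not_or] at hr
      simp [rounds, hr.1]
    | succ m ih =>
      intro hm
      obtain ⟨h1, h2, h3⟩ := ih (by omega)
      refine ⟨succ m (by omega) _ h2 h3 h1, ⟨fun r hr => ?_, fun k hk => ?_⟩, by simp [rounds]⟩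
      · have hr' := hr
        simp only [regs, List.mem_cons, not_or] at hr'
        simp [rounds, hr'.1, den_reg hr'.2, h2.reg r hr]
      · have hk' : k ∉ p.arrs := hk
        simp [rounds, den_arr hk', h2.arr k hk]
  exact (this _ le_rfl).1

/-! ### Correctness and running time of compiled commands -/

theorem WF.seq_left {p q : Cmd} (h : (seq p q).WF) : p.WF := by
  simp_all [WF, counting, regs]
theorem WF.seq_right {p q : Cmd} (h : (seq p q).WF) : q.WF := by
  simp_all [WF, counting, regs]
theorem WF.ifLt_left {x y : ℕ} {p q : Cmd} (h : (ifLt x y p q).WF) : p.WF := by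
  simp_all [WF, counting, regs]
theorem WF.ifLt_right {x y : ℕ} {p q : Cmd} (h : (ifLt x y p q).WF) : q.WF := by
  simp_all [WF, counting, regs]
theorem WF.loop_body {x : ℕ} {p : Cmd} (h : (loop x p).WF) : p.WF := by
  simp_all [WF, counting, regs]

/-- A compiled command computes its effect within its time bound. -/
theorem compile_run {c : Cmd} (hc : c.WF) (s : St) :
    ∃ t ≤ c.time.eval (s.reg 1), ∀ k, step^[t] (s.cfg (c.compile :: k)) = (c.den s).cfg k := by
  induction c generalizing s with
  | seq p q hp hq =>
    obtain ⟨t, ht, h⟩ := hp hc.seq_left s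
    obtain ⟨t', ht', h'⟩ := hq hc.seq_right (p.den s)
    rw [den_reg hc.seq_left.2] at ht'
    refine ⟨t' + (t + 1), by simp [time]; omega, fun k => ?_⟩
    rw [Function.iterate_add_apply, Function.iterate_succ_apply]
    exact (congrArg _ (h _)).trans (h' k)
  | ifLt x y p q hp hq =>
    by_cases hxy : s.reg x < s.reg y
    · obtain ⟨t, ht, h⟩ := hp hc.ifLt_left s
      refine ⟨t + 1, by simp [time]; omega, fun k => ?_⟩
      rw [Function.iterate_succ_apply]
      simpa [den, hxy, compile, step, St.cfg] using h k
    · obtain ⟨t, ht, h⟩ := hq hc.ifLt_right s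
      refine ⟨t + 1, by simp [time]; omega, fun k => ?_⟩
      rw [Function.iterate_succ_apply]
      simpa [den, hxy, compile, step, St.cfg] using h k
  | loop x p hp =>
    have hx : x ∉ p.regs := by
      have := hc.1
      simp_all [counting]
    have hx1 : x ≠ 1 := by
      have := hc.2
      simp only [regs, List.mem_cons, not_or] at this
      exact fun h => this.1 h.symm
    have hreg : ∀ m, (rounds p.den x s m).reg x = m ∧ (rounds p.den x s m).reg 1 = s.reg 1 := by
      intro m
      induction m with
      | zero => simp [rounds, hx1.symm]
      | succ m ih => simp [rounds, hx1.symm, den_reg hc.loop_body.2, ih.2]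
    -- The summand 2 pays for unfolding the outer `seq` and resetting the counter; the 3 in each
    -- round pays for the test, for unfolding the inner `seq`, and for the increment.
    have main : ∀ m ≤ s.reg 1, ∃ t ≤ m * (p.time.eval (s.reg 1) + 3) + 2, ∀ k,
        step^[t] (s.cfg ((loop x p).compile :: k)) =
          (rounds p.den x s m).cfg (.whileLt x 1 (.seq p.compile (.inc x)) :: k) := by
      intro m
      induction m with
      | zero => exact fun _ => ⟨2, by omega, fun k => rfl⟩
      | succ m ih =>
        intro hm
        obtain ⟨t, ht, h⟩ := ih (by omega)
        obtain ⟨t', ht', h'⟩ := hp hc.loop_body (rounds p.den x s m)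
        rw [(hreg m).2] at ht'
        refine ⟨1 + (t' + (2 + t)), ?_, fun k => ?_⟩
        · rw [Nat.succ_mul]; omega
        · rw [Function.iterate_add_apply, Function.iterate_add_apply, Function.iterate_add_apply,
            h k]
          have e : step^[2] ((rounds p.den x s m).cfg
              (.whileLt x 1 (.seq p.compile (.inc x)) :: k)) = (rounds p.den x s m).cfg
              (p.compile :: .inc x :: .whileLt x 1 (.seq p.compile (.inc x)) :: k) := by
            have hlt : (rounds p.den x s m).reg x < (rounds p.den x s m).reg 1 := by
              rw [(hreg m).1, (hreg m).2]; omega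
            simp [Function.iterate_succ_apply, step, St.cfg, hlt]
          rw [e, h']
          have hr : (p.den (rounds p.den x s m)).reg x = m := by
            rw [den_reg hx, (hreg m).1]
          simp [step, St.cfg, rounds, St.set, hr]
    obtain ⟨t, ht, h⟩ := main (s.reg 1) le_rfl
    -- The extra step is the failing test that leaves the loop.
    refine ⟨1 + t, by simp [time]; omega, fun k => ?_⟩
    rw [Function.iterate_add_apply, h k]
    simp [step, St.cfg, (hreg _).1, (hreg _).2, den]
  | _ => exact ⟨1, by simp [time], fun k => rfl⟩

end Cmd

/-! ### Delay from checkpoints -/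

theorem out_length_le_step (c : Cfg) : c.out.length ≤ (step c).out.length := by
  rcases c with ⟨todo, reg, arr, buf, out⟩
  cases todo with
  | nil => simp [step]
  | cons p k => cases p <;> simp [step]

theorem out_length_mono (c : Cfg) : Monotone fun t => (step^[t] c).out.length :=
  monotone_nat_of_le_succ fun t => by
    simpa only [Function.iterate_succ_apply'] using out_length_le_step _

theorem Cfg.Halted.iterate {c : Cfg} (h : c.Halted) (t : ℕ) : step^[t] c = c := by
  have : step c = c := by simp [step, show c.todo = [] from h]
  exact Function.iterate_fixed this t

theorem halted_mono {c : Cfg} {t t' : ℕ} (h : (step^[t] c).Halted) (ht : t ≤ t') :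
    step^[t'] c = step^[t] c := by
  obtain ⟨d, rfl⟩ := Nat.exists_eq_add_of_le' ht
  rw [Function.iterate_add_apply, h.iterate]

/-- Within `d` steps from `c` a new output is delivered or the machine halts. -/
def Progress (d : ℕ) (c : Cfg) : Prop :=
  c.out.length < (step^[d] c).out.length ∨ (step^[d] c).Halted

/-- If the machine moves within `d` steps from each checkpoint to another one, after an output, or
halts, then it reaches its end, with delay at most `2 * d`. -/
theorem progress_of_checkpoints {d : ℕ} {Inv : Cfg → Prop} {Good : List (List ℕ) → Prop}
    (μ : Cfg → ℕ)
    (next : ∀ c, Inv c → ∃ t ≤ d, c.out.length < (step^[t] c).out.length ∧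
      ((Inv (step^[t] c) ∧ μ (step^[t] c) < μ c) ∨
        ((step^[t] c).Halted ∧ Good (step^[t] c).out)))
    (c : Cfg) (hc : Inv c) :
    (∃ T, (step^[T] c).Halted ∧ Good (step^[T] c).out) ∧ ∀ t, Progress (2 * d) (step^[t] c) := by
  have first : ∀ c, Inv c → c.out.length < (step^[d] c).out.length := by
    intro c hc
    obtain ⟨t, ht, h, -⟩ := next c hc
    exact h.trans_le (out_length_mono c ht)
  induction hm : μ c using Nat.strong_induction_on generalizing c with
  | _ m ih =>
    obtain ⟨t₁, ht₁, hout, ⟨hI, hμ⟩ | ⟨hH, hG⟩⟩ := next c hc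
    · obtain ⟨⟨T, hT, hTG⟩, hdel⟩ := ih _ (hm ▸ hμ) _ hI rfl
      refine ⟨⟨T + t₁, by rwa [Function.iterate_add_apply],
        by rwa [Function.iterate_add_apply]⟩, fun t => ?_⟩
      rcases le_total t₁ t with h | h
      · obtain ⟨e, rfl⟩ := Nat.exists_eq_add_of_le' h
        rw [Function.iterate_add_apply]
        exact hdel e
      · left
        rw [← Function.iterate_add_apply]
        -- At time `t` the output of the current round may already be out. The next checkpoint comes
        -- by time `t₁ ≤ d`, and another output follows within `d` steps of it; this is where the
        -- factor 2 comes from.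
        have h1 := first _ hI
        rw [← Function.iterate_add_apply] at h1
        exact ((out_length_mono c h).trans_lt h1).trans_le
          (out_length_mono c (by omega : d + t₁ ≤ 2 * d + t))
    · refine ⟨⟨t₁, hH, hG⟩, fun t => Or.inr ?_⟩
      rw [← Function.iterate_add_apply, halted_mono hH (by omega)]
      exact hH

theorem eval_mono_nat (p : Polynomial ℕ) : Monotone fun n => p.eval n := by
  intro a b h
  simp only [Polynomial.eval_eq_sum_range]
  gcongr

end EnumRAM
/-! ### Matchings by auction -/

/-- A state of the auction on a bipartite graph with parts `H` and `{0, …, n - 1} \ H`: `fl` marks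
the matched vertices, `mt` gives their mates, and `pr` gives the prices of the second part. -/
structure Auction (n : ℕ) (H : Finset ℕ) (adj : ℕ → ℕ → Prop) (fl mt pr : ℕ → ℕ) : Prop where
  head : ∀ u ∈ H, 0 < fl u →
    mt u < n ∧ mt u ∉ H ∧ adj u (mt u) ∧ 0 < fl (mt u) ∧ mt (mt u) = u
  crown : ∀ c < n, c ∉ H → 0 < fl c → mt c ∈ H ∧ 0 < fl (mt c) ∧ mt (mt c) = c
  free : ∀ c < n, c ∉ H → fl c = 0 → pr c = 0
  slack : ∀ u ∈ H, 0 < fl u → ∀ c < n, c ∉ H → adj u c → pr (mt u) ≤ pr c + 1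
  bound : ∀ c < n, c ∉ H → pr c ≤ n

/-- The neighbour `c` of `u` in the second part has the least price, which is less than `n`. -/
structure IsCheapest (n : ℕ) (H : Finset ℕ) (adj : ℕ → ℕ → Prop) (pr : ℕ → ℕ) (u c : ℕ) :
    Prop where
  lt : c < n
  notMem : c ∉ H
  edge : adj u c
  price_lt : pr c < n
  le : ∀ d < n, d ∉ H → adj u d → pr c ≤ pr d

/-- There is a matching of `H` into its complement in `{0, …, n - 1}`. -/
def Matchable (n : ℕ) (H : Finset ℕ) (adj : ℕ → ℕ → Prop) : Prop :=
  ∃ M : ℕ → ℕ, Set.InjOn M H ∧ ∀ h ∈ H, M h < n ∧ M h ∉ H ∧ adj h (M h)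

/-- The total price. -/
def totalPrice (n : ℕ) (H : Finset ℕ) (pr : ℕ → ℕ) : ℕ := ∑ c ∈ Finset.range n \ H, pr c

/-- The marks after `u` has been matched to `c`. -/
def bidFlag (fl mt : ℕ → ℕ) (u c : ℕ) : ℕ → ℕ :=
  Function.update (Function.update (if 0 < fl c then Function.update fl (mt c) 0 else fl) c 1) u 1

/-- The mates after `u` has been matched to `c`. -/
def bidMate (mt : ℕ → ℕ) (u c : ℕ) : ℕ → ℕ := Function.update (Function.update mt c u) u c

section Auction

variable {n : ℕ} {H : Finset ℕ} {adj : ℕ → ℕ → Prop} {fl mt pr : ℕ → ℕ}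

theorem auction_init : Auction n H adj (fun _ => 0) mt (fun _ => 0) := by
  constructor <;> simp

/-- Slackness survives for `u` because `c` was its cheapest neighbour, so the new price is at most
one above the others. For any other vertex still matched, the price of its mate is unchanged and the
remaining prices can only go up. No crown vertex becomes free, so free ones keep price 0, and the
bound holds because the old price was below `n`. -/
theorem Auction.bid (h : Auction n H adj fl mt pr) {u c : ℕ} (hu : u ∈ H) (hfu : fl u = 0)
    (hc : IsCheapest n H adj pr u c) :
    Auction n H adj (bidFlag fl mt u c) (bidMate mt u c)
      (Function.update pr c (pr c + 1)) := by
  obtain ⟨hcn, hcH, huc, hpc, hle⟩ := hc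
  have hne : c ≠ u := fun e => hcH (e ▸ hu)
  have fl_eq : ∀ x, bidFlag fl mt u c x =
      if x = u then 1 else if x = c then 1 else if 0 < fl c ∧ x = mt c then 0 else fl x := by
    intro x
    unfold bidFlag
    by_cases hf : 0 < fl c <;> simp [Function.update_apply, hf]
  have mt_eq : ∀ x, bidMate mt u c x = if x = u then c else if x = c then u else mt x := by
    intro x
    simp [bidMate, Function.update_apply]
  have pr_eq : ∀ x, Function.update pr c (pr c + 1) x = if x = c then pr c + 1 else pr x := by
    intro x
    simp [Function.update_apply]
  obtain ⟨h1, h2, h3, h4, h5⟩ := h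
  refine ⟨fun v hv hf => ?_, fun d hd hdH hf => ?_, fun d hd hdH hf => ?_,
    fun v hv hf d hd hdH hvd => ?_, fun d hd hdH => ?_⟩
  · simp only [fl_eq, mt_eq] at hf ⊢
    have := h1 v hv
    have := h2 c hcn hcH
    grind
  · simp only [fl_eq, mt_eq] at hf ⊢
    have := h2 d hd hdH
    have := h1 (mt d)
    have := h2 c hcn hcH
    grind
  · simp only [fl_eq, pr_eq] at hf ⊢
    have := h3 d hd hdH
    have := h2 c hcn hcH
    grind
  · simp only [fl_eq, mt_eq, pr_eq] at hf ⊢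
    have hle' := hle d hd hdH
    clear h5 fl_eq mt_eq pr_eq hpc hle
    have hvd' : v ≠ c := fun e => hcH (e ▸ hv)
    by_cases hvu : v = u
    · subst hvu
      have := hle' hvd
      split_ifs <;> simp_all
    · simp only [hvu, hvd', if_false] at hf ⊢
      have hfv : 0 < fl v ∧ ¬ (0 < fl c ∧ v = mt c) := by
        split_ifs at hf with h'
        · exact absurd hf (lt_irrefl 0)
        · exact ⟨hf, h'⟩
      have hmv := h1 v hv hfv.1
      -- If `c` were the mate of `v`, then `v` would be the displaced owner of `c`, which is no
      -- longer matched.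
      have hne' : mt v ≠ c := fun e => hfv.2 ⟨e ▸ hmv.2.2.2.1, by rw [← e, hmv.2.2.2.2]⟩
      have := h4 v hv hfv.1 d hd hdH hvd
      rw [if_neg hne']
      split_ifs with hdc
      · subst hdc; omega
      · exact this
  · simp only [pr_eq]
    have := h5 d hd hdH
    grind

theorem totalPrice_bid {u c : ℕ} (hc : IsCheapest n H adj pr u c) :
    totalPrice n H (Function.update pr c (pr c + 1)) = totalPrice n H pr + 1 := by
  have hm : c ∈ Finset.range n \ H := by simp [hc.lt, hc.notMem]
  unfold totalPrice
  rw [Finset.sum_update_of_mem hm, ← Finset.add_sum_erase _ _ hm, Finset.sdiff_singleton_eq_erase]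
  omega

/-- Suppose that all crown neighbours of the unmatched `u` cost at least `n`. Crown vertices of
positive price are matched, so those of price at least n - j have distinct owners, all different
from `u`. The matching `M` sends these owners and `u` to distinct crown vertices, which cost at
least n - j - 1 by slackness. So the number of vertices above the threshold grows each time the
threshold drops by one, until there are more than `n` of them. -/
theorem Auction.exists_price_lt (h : Auction n H adj fl mt pr) (hM : Matchable n H adj)
    {u : ℕ} (hu : u ∈ H) (hfu : fl u = 0) :
    ∃ c < n, c ∉ H ∧ adj u c ∧ pr c < n := by
  obtain ⟨M, hinj, hM⟩ := hM
  by_contra! hcon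
  have key : ∀ j ≤ n, j + 1 ≤ ((Finset.range n \ H).filter fun c => n - j ≤ pr c).card := by
    intro j
    induction j with
    | zero =>
      intro _
      refine Finset.card_pos.2 ⟨M u, ?_⟩
      obtain ⟨a, b, c⟩ := hM u hu
      simp [a, b, hcon _ a b c]
    | succ j ih =>
      intro hj
      have ih := ih (by omega)
      set T := (Finset.range n \ H).filter fun c => n - j ≤ pr c
      have hT : ∀ c ∈ T, c < n ∧ c ∉ H ∧ n - j ≤ pr c ∧ mt c ∈ H ∧ 0 < fl (mt c) ∧
          mt (mt c) = c := by
        intro c hc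
        simp only [T, Finset.mem_filter, Finset.mem_sdiff, Finset.mem_range] at hc
        have h0 : 0 < fl c := by
          by_contra h0
          have := h.free c hc.1.1 hc.1.2 (by omega)
          omega
        exact ⟨hc.1.1, hc.1.2, hc.2, h.crown c hc.1.1 hc.1.2 h0⟩
      have hmt : Set.InjOn mt T := by
        intro a ha b hb hab
        rw [← (hT a ha).2.2.2.2.2, ← (hT b hb).2.2.2.2.2, hab]
      have hnot : u ∉ T.image mt := by
        intro hmem
        obtain ⟨c, hc, rfl⟩ := Finset.mem_image.1 hmem
        have := (hT c hc).2.2.2.2.1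
        omega
      have hsub : insert u (T.image mt) ⊆ H := by
        intro x hx
        rcases Finset.mem_insert.1 hx with rfl | hx
        · exact hu
        · obtain ⟨c, hc, rfl⟩ := Finset.mem_image.1 hx
          exact (hT c hc).2.2.2.1
      have hcard : ((insert u (T.image mt)).image M).card = T.card + 1 := by
        rw [Finset.card_image_of_injOn (hinj.mono (by exact_mod_cast hsub)),
          Finset.card_insert_of_notMem hnot, Finset.card_image_of_injOn hmt]
      refine le_trans (by omega : j + 1 + 1 ≤ T.card + 1) (hcard ▸ Finset.card_le_card ?_)
      intro x hx
      obtain ⟨y, hy, rfl⟩ := Finset.mem_image.1 hx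
      obtain ⟨a, b, c⟩ := hM y (hsub hy)
      simp only [Finset.mem_filter, Finset.mem_sdiff, Finset.mem_range]
      refine ⟨⟨a, b⟩, ?_⟩
      rcases Finset.mem_insert.1 hy with rfl | hy
      · have := hcon _ a b c
        omega
      · obtain ⟨e, he, rfl⟩ := Finset.mem_image.1 hy
        have h1 := hT e he
        have := h.slack (mt e) h1.2.2.2.1 h1.2.2.2.2.1 _ a b c
        rw [h1.2.2.2.2.2] at this
        omega
  have h1 := key n le_rfl
  have h2 := (Finset.card_filter_le (Finset.range n \ H) fun c => n - n ≤ pr c).trans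
    (Finset.card_le_card Finset.sdiff_subset)
  rw [Finset.card_range] at h2
  omega

/-- A vertex in the head leaves fewer than `n` crown vertices, each of price at most `n`. The head
must be nonempty for the strict inequality when `n = 0`. -/
theorem Auction.totalPrice_lt (h : Auction n H adj fl mt pr) {u : ℕ} (hu : u ∈ H) (hun : u < n) :
    totalPrice n H pr < n * n := by
  have h1 : totalPrice n H pr ≤ (Finset.range n \ H).card * n := by
    refine Finset.sum_le_card_nsmul _ _ _ fun c hc => ?_
    rw [Finset.mem_sdiff, Finset.mem_range] at hc
    exact h.bound c hc.1 hc.2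
  have h2 : (Finset.range n \ H).card < n := by
    have : Finset.range n \ H ⊂ Finset.range n :=
      Finset.ssubset_iff_subset_ne.2 ⟨Finset.sdiff_subset, fun e => by
        have : u ∈ Finset.range n \ H := by rw [e]; exact Finset.mem_range.2 hun
        exact (Finset.mem_sdiff.1 this).2 hu⟩
    simpa using Finset.card_lt_card this
  exact h1.trans_lt (Nat.mul_lt_mul_of_pos_right h2 (by omega))

end Auction

/-! ### Closed independent sets in colexicographic order -/

/-- `A` is closed under the relation `E`. -/
def ClosedUnder (E : ℕ → ℕ → Prop) (A : Finset ℕ) : Prop := ∀ u ∈ A, ∀ v, E u v → v ∈ A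

/-- `A` is a subset of `H`, closed under `E` and independent for `adj`. -/
structure ClosedIndep (H : Finset ℕ) (E adj : ℕ → ℕ → Prop) (A : Finset ℕ) : Prop where
  subset : A ⊆ H
  closed : ClosedUnder E A
  indep : ∀ u ∈ A, ∀ v ∈ A, ¬ adj u v

/-- The part of `A` above `i`, together with `i`. -/
def raise (A : Finset ℕ) (i : ℕ) : Finset ℕ := insert i (A.filter (i < ·))

/-- `B` is the least `E`-closed set containing `F`. -/
structure IsClosureOf (E : ℕ → ℕ → Prop) (F B : Finset ℕ) : Prop where
  subset : F ⊆ B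
  closed : ClosedUnder E B
  least : ∀ D, F ⊆ D → ClosedUnder E D → B ⊆ D

/-- The candidate `B` for the successor of `A` at `i` is admissible. -/
structure Admissible (H : Finset ℕ) (adj : ℕ → ℕ → Prop) (A : Finset ℕ) (i : ℕ)
    (B : Finset ℕ) : Prop where
  mem : i ∈ H
  notMem : i ∉ A
  agree : ∀ x ∈ B, i < x → x ∈ A
  indep : ∀ u ∈ B, ∀ v ∈ B, ¬ adj u v

/-- The witness `w` is the largest element on which the two sets differ, and it belongs to the
larger set. -/
theorem colex_lt_iff {A D : Finset ℕ} :
    toColex A < toColex D ↔ ∃ w, w ∈ D ∧ w ∉ A ∧ ∀ x, w < x → (x ∈ A ↔ x ∈ D) := by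
  rw [Finset.Colex.lt_iff_exists_filter_lt]
  constructor
  · rintro ⟨w, hw, h⟩
    simp only [Finset.mem_sdiff] at hw
    refine ⟨w, hw.1, hw.2, fun x hx => ?_⟩
    have := Finset.ext_iff.1 h x
    simpa [hx] using this
  · rintro ⟨w, h1, h2, h⟩
    refine ⟨w, by simp [h1, h2], ?_⟩
    ext x
    simp only [Finset.mem_filter]
    constructor
    · rintro ⟨a, b⟩
      exact ⟨(h x b).1 a, b⟩
    · rintro ⟨a, b⟩
      exact ⟨(h x b).2 a, b⟩

section Closed

variable {H : Finset ℕ} {E adj : ℕ → ℕ → Prop} {A B : Finset ℕ} {i : ℕ}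

theorem Admissible.lt (h : Admissible H adj A i B) (hB : IsClosureOf E (raise A i) B) :
    toColex A < toColex B := by
  refine colex_lt_iff.2 ⟨i, hB.subset (by simp [raise]), h.notMem, fun x hx => ⟨fun hA => ?_,
    fun hxB => h.agree x hxB hx⟩⟩
  exact hB.subset (by simp [raise, hA, hx])

theorem Admissible.closedIndep (h : Admissible H adj A i B) (hA : ClosedIndep H E adj A)
    (hE : ∀ u v, E u v → v ∈ H) (hB : IsClosureOf E (raise A i) B) : ClosedIndep H E adj B := by
  refine ⟨hB.least H ?_ fun u _ v huv => hE u v huv, hB.closed, h.indep⟩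
  intro x hx
  simp only [raise, Finset.mem_insert, Finset.mem_filter] at hx
  rcases hx with rfl | hx
  · exact h.mem
  · exact hA.subset hx.1

/-- Take for `w` the largest difference. The closed set `D` contains `raise A w`, hence its closure,
and the closure inherits from `D` both independence and agreement with `A` above `w`. -/
theorem exists_admissible {D : Finset ℕ} (hD : ClosedIndep H E adj D)
    (hlt : toColex A < toColex D) (cl : ℕ → Finset ℕ)
    (hcl : ∀ i ∈ H, IsClosureOf E (raise A i) (cl i)) :
    ∃ w, w ∈ D ∧ (∀ x, w < x → (x ∈ A ↔ x ∈ D)) ∧ Admissible H adj A w (cl w) := by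
  obtain ⟨w, hwD, hwA, hw⟩ := colex_lt_iff.1 hlt
  have hsub : cl w ⊆ D := by
    refine (hcl w (hD.subset hwD)).least D (fun x hx => ?_) hD.closed
    simp only [raise, Finset.mem_insert, Finset.mem_filter] at hx
    rcases hx with rfl | hx
    · exact hwD
    · exact (hw x hx.2).1 hx.1
  exact ⟨w, hwD, hw, hD.subset hwD, hwA, fun x hx hwx => (hw x hwx).2 (hsub hx),
    fun u hu v hv => hD.indep u (hsub hu) v (hsub hv)⟩

/-- The least admissible position gives the immediate successor. -/
theorem Admissible.le {cl : ℕ → Finset ℕ} (h : Admissible H adj A i (cl i))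
    (hcl : ∀ i ∈ H, IsClosureOf E (raise A i) (cl i))
    (hmin : ∀ j < i, ¬ Admissible H adj A j (cl j)) {D : Finset ℕ}
    (hD : ClosedIndep H E adj D) (hlt : toColex A < toColex D) :
    toColex (cl i) ≤ toColex D := by
  obtain ⟨w, hwD, hw, hadm⟩ := exists_admissible hD hlt cl hcl
  have hB := hcl i h.mem
  rcases lt_trichotomy w i with hwi | rfl | hiw
  · exact absurd hadm (hmin w hwi)
  · refine Finset.Colex.toColex_mono (hB.least D (fun x hx => ?_) hD.closed)
    simp only [raise, Finset.mem_insert, Finset.mem_filter] at hx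
    rcases hx with rfl | hx
    · exact hwD
    · exact (hw x hx.2).1 hx.1
  -- Here the candidate agrees with `A` above `i`, in particular from `w` on, whereas `D` contains
  -- `w` and `A` does not; so `w` already separates the candidate from `D`.
  · refine (colex_lt_iff.2 ⟨w, hwD, fun hwB => hadm.notMem (h.agree w hwB hiw), fun x hx => ?_⟩).le
    rw [← hw x hx]
    refine ⟨fun hxB => h.agree x hxB (hiw.trans hx), fun hxA => hB.subset ?_⟩
    simp [raise, hxA, hiw.trans hx]

end Closed

/-! ### Small vertex covers and closed independent sets -/

/-- The matching `mt` pairs `H` with `{0, …, n - 1} \ H` along edges. -/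
structure IsMate (n : ℕ) (H : Finset ℕ) (adj : ℕ → ℕ → Prop) (mt : ℕ → ℕ) : Prop where
  head : ∀ u ∈ H, mt u < n ∧ mt u ∉ H ∧ adj u (mt u) ∧ mt (mt u) = u
  crown : ∀ c < n, c ∉ H → mt c ∈ H ∧ mt (mt c) = c

/-- The relation `u → v` on `H`: a cover without `u` contains the mate of `v`. -/
def Forces (H : Finset ℕ) (adj : ℕ → ℕ → Prop) (mt : ℕ → ℕ) (u v : ℕ) : Prop :=
  v ∈ H ∧ adj u (mt v)

/-- The cover that belongs to a subset of the head. -/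
def coverOf (n : ℕ) (H : Finset ℕ) (mt : ℕ → ℕ) (A : Finset ℕ) : Finset ℕ :=
  (Finset.range n).filter fun v => if v ∈ H then v ∉ A else mt v ∈ A

section Cover

variable {n : ℕ} {H : Finset ℕ} {adj : ℕ → ℕ → Prop} {fl mt pr : ℕ → ℕ}

/-- Mates of head vertices are distinct; since the two sides have the same size, they exhaust the
crown. -/
theorem Auction.isMate (h : Auction n H adj fl mt pr) (hall : ∀ u ∈ H, 0 < fl u)
    (hcard : (Finset.range n \ H).card = H.card) : IsMate n H adj mt := by
  have hinj : Set.InjOn mt H := by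
    intro a ha b hb hab
    rw [← (h.head a ha (hall a ha)).2.2.2.2, ← (h.head b hb (hall b hb)).2.2.2.2, hab]
  have himg : H.image mt = Finset.range n \ H := by
    refine Finset.eq_of_subset_of_card_le (fun x hx => ?_) ?_
    · obtain ⟨u, hu, rfl⟩ := Finset.mem_image.1 hx
      have := h.head u hu (hall u hu)
      simp [this.1, this.2.1]
    · rw [Finset.card_image_of_injOn hinj, hcard]
  refine ⟨fun u hu => ?_, fun c hc hcH => ?_⟩
  · have := h.head u hu (hall u hu)
    exact ⟨this.1, this.2.1, this.2.2.1, this.2.2.2.2⟩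
  · have hmem : c ∈ H.image mt := by rw [himg]; simp [hc, hcH]
    obtain ⟨u, hu, rfl⟩ := Finset.mem_image.1 hmem
    have := (h.head u hu (hall u hu)).2.2.2.2
    rw [this]
    exact ⟨hu, rfl⟩

theorem IsMate.card_coverOf (h : IsMate n H adj mt) (hH : H ⊆ Finset.range n) {A : Finset ℕ}
    (hA : A ⊆ H) : (coverOf n H mt A).card = H.card := by
  have e : coverOf n H mt A = (H \ A) ∪ A.image mt := by
    ext v
    simp only [coverOf, Finset.mem_filter, Finset.mem_range, Finset.mem_union, Finset.mem_sdiff,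
      Finset.mem_image]
    constructor
    · rintro ⟨hv, hv'⟩
      by_cases hvH : v ∈ H
      · left; simpa [hvH] using hv'
      · right
        simp only [hvH, if_false] at hv'
        exact ⟨mt v, hv', (h.crown v hv hvH).2⟩
    · rintro (⟨hv, hv'⟩ | ⟨u, hu, rfl⟩)
      · exact ⟨Finset.mem_range.1 (hH hv), by simp [hv, hv']⟩
      · have := h.head u (hA hu)
        exact ⟨this.1, by simp [this.2.1, this.2.2.2, hu]⟩
  rw [e, Finset.card_union_of_disjoint, Finset.card_image_of_injOn, Finset.card_sdiff_of_subset hA]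
  · have := Finset.card_le_card hA
    omega
  · intro a ha b hb hab
    rw [← (h.head a (hA ha)).2.2.2, ← (h.head b (hA hb)).2.2.2, hab]
  · rw [Finset.disjoint_left]
    intro x hx hx'
    obtain ⟨u, hu, rfl⟩ := Finset.mem_image.1 hx'
    exact (h.head u (hA hu)).2.1 (Finset.mem_sdiff.1 hx).1

/-- Independence of `A` covers the edges inside the head, closedness covers those between head and
crown, and there are no others by `hC`. -/
theorem IsMate.coverOf_isCover (h : IsMate n H adj mt) {A : Finset ℕ}
    (hsymm : ∀ u v, adj u v → adj v u) (hC : ∀ u v, adj u v → u ∈ H ∨ v ∈ H)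
    (hA : ClosedIndep H (Forces H adj mt) adj A) {u v : ℕ} (hu : u < n) (hv : v < n)
    (huv : adj u v) : u ∈ coverOf n H mt A ∨ v ∈ coverOf n H mt A := by
  simp only [coverOf, Finset.mem_filter, Finset.mem_range, hu, hv, true_and]
  have key : ∀ u v, v < n → u ∈ H → v ∉ H → adj u v → u ∈ A → mt v ∈ A := by
    intro u v hv huH hvH huv huA
    have := h.crown v hv hvH
    exact hA.closed u huA (mt v) ⟨this.1, by rwa [this.2]⟩
  by_cases huH : u ∈ H <;> by_cases hvH : v ∈ H
  · simp only [huH, hvH, if_true]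
    by_contra! hcon
    exact hA.indep u hcon.1 v hcon.2 huv
  · simp only [huH, hvH, if_true, if_false]
    by_cases huA : u ∈ A
    · exact Or.inr (key u v hv huH hvH huv huA)
    · exact Or.inl huA
  · simp only [huH, hvH, if_true, if_false]
    by_cases hvA : v ∈ A
    · exact Or.inl (key v u hu hvH huH (hsymm _ _ huv) hvA)
    · exact Or.inr hvA
  · rcases hC u v huv with h | h
    · exact absurd h huH
    · exact absurd h hvH

/-- The mates of the omitted head vertices must be in `S`. As `|S| = |H|`, there is no room for
further crown vertices, so `S \ H` consists exactly of these mates. Both closedness and the recovery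
of `S` follow from this equality. -/
theorem IsMate.exists_coverOf_eq (h : IsMate n H adj mt) (hH : H ⊆ Finset.range n)
    {S : Finset ℕ} (hS : S ⊆ Finset.range n) (hcard : S.card = H.card)
    (hcov : ∀ u < n, ∀ v < n, adj u v → u ∈ S ∨ v ∈ S) :
    ClosedIndep H (Forces H adj mt) adj (H \ S) ∧ coverOf n H mt (H \ S) = S := by
  have hsub : (H \ S).image mt ⊆ S \ H := by
    intro x hx
    obtain ⟨u, hu, rfl⟩ := Finset.mem_image.1 hx
    obtain ⟨huH, huS⟩ := Finset.mem_sdiff.1 hu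
    have hm := h.head u huH
    rcases hcov u (Finset.mem_range.1 (hH huH)) _ hm.1 hm.2.2.1 with h' | h'
    · exact absurd h' huS
    · exact Finset.mem_sdiff.2 ⟨h', hm.2.1⟩
  have heq : (H \ S).image mt = S \ H := by
    refine Finset.eq_of_subset_of_card_le hsub ?_
    rw [Finset.card_image_of_injOn]
    · have h1 := Finset.card_sdiff_add_card_inter S H
      have h2 := Finset.card_sdiff_add_card_inter H S
      rw [Finset.inter_comm] at h2
      omega
    · intro a ha b hb hab
      simp only [Finset.coe_sdiff, Set.mem_sdiff, Finset.mem_coe] at ha hb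
      rw [← (h.head a ha.1).2.2.2, ← (h.head b hb.1).2.2.2, hab]
  have hmem : ∀ c < n, c ∉ H → (mt c ∈ H \ S ↔ c ∈ S) := by
    intro c hc hcH
    constructor
    · intro hm
      have : mt (mt c) ∈ S \ H := heq ▸ Finset.mem_image_of_mem mt hm
      rw [(h.crown c hc hcH).2] at this
      exact (Finset.mem_sdiff.1 this).1
    · intro hcS
      have : c ∈ (H \ S).image mt := by rw [heq]; simp [hcS, hcH]
      obtain ⟨u, hu, rfl⟩ := Finset.mem_image.1 this
      rwa [(h.head u (Finset.mem_sdiff.1 hu).1).2.2.2]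
  refine ⟨⟨Finset.sdiff_subset, fun u hu v hv => ?_, fun u hu v hv huv => ?_⟩, ?_⟩
  · obtain ⟨huH, huS⟩ := Finset.mem_sdiff.1 hu
    have hm := h.head v hv.1
    have := (hcov u (Finset.mem_range.1 (hH huH)) _ hm.1 hv.2).resolve_left huS
    rw [← hmem _ hm.1 hm.2.1, hm.2.2.2] at this
    exact this
  · simp only [Finset.mem_sdiff] at hu hv
    rcases hcov u (Finset.mem_range.1 (hH hu.1)) v (Finset.mem_range.1 (hH hv.1)) huv with h' | h'
    · exact hu.2 h'
    · exact hv.2 h'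
  · ext v
    simp only [coverOf, Finset.mem_filter, Finset.mem_range]
    by_cases hvH : v ∈ H
    · have := Finset.mem_range.1 (hH hvH)
      simp [hvH, this]
    · simp only [hvH, if_false]
      constructor
      · rintro ⟨a, b⟩
        exact (hmem v a hvH).1 b
      · intro a
        have hv := Finset.mem_range.1 (hS a)
        exact ⟨hv, (hmem v hv hvH).2 a⟩

theorem coverOf_injOn (hH : H ⊆ Finset.range n) {A D : Finset ℕ} (hA : A ⊆ H) (hD : D ⊆ H)
    (h : coverOf n H mt A = coverOf n H mt D) : A = D := by
  ext v
  have := Finset.ext_iff.1 h v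
  by_cases hv : v ∈ H
  · have hvn := Finset.mem_range.1 (hH hv)
    simp only [coverOf, Finset.mem_filter, Finset.mem_range, hvn, hv, if_true, true_and] at this
    exact not_iff_not.1 this
  · exact ⟨fun h => absurd (hA h) hv, fun h => absurd (hD h) hv⟩

end Cover

/-! ### The least closed set -/

open Classical in
/-- The least `E`-closed superset of `F`, for a relation `E` with values in `H`. -/
noncomputable def leastClosed (H : Finset ℕ) (E : ℕ → ℕ → Prop) (F : Finset ℕ) : Finset ℕ :=
  (F ∪ H).filter fun x => ∀ D, F ⊆ D → ClosedUnder E D → x ∈ D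

theorem isClosureOf_leastClosed {H : Finset ℕ} {E : ℕ → ℕ → Prop} (hE : ∀ u v, E u v → v ∈ H)
    (F : Finset ℕ) : IsClosureOf E F (leastClosed H E F) := by
  refine ⟨fun x hx => ?_, fun u hu v huv => ?_, fun D hFD hD x hx => ?_⟩
  · simp only [leastClosed, Finset.mem_filter, Finset.mem_union]
    exact ⟨Or.inl hx, fun D hFD _ => hFD hx⟩
  · simp only [leastClosed, Finset.mem_filter, Finset.mem_union] at hu ⊢
    exact ⟨Or.inr (hE u v huv), fun D hFD hD => hD u (hu.2 D hFD hD) v huv⟩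
  · simp only [leastClosed, Finset.mem_filter] at hx
    exact hx.2 D hFD hD

/-- Uniqueness of the least closed set identifies what the machine computes with a set defined
without reference to the machine. -/
theorem IsClosureOf.eq_leastClosed {H : Finset ℕ} {E : ℕ → ℕ → Prop} (hE : ∀ u v, E u v → v ∈ H)
    {F B : Finset ℕ} (h : IsClosureOf E F B) : B = leastClosed H E F :=
  have h' := isClosureOf_leastClosed hE F
  (h.least _ h'.subset h'.closed).antisymm (h'.least _ h.subset h.closed)
namespace EnumRAM

open Cmd

/-! ### Reading the input -/

/-- The array `inp` describes the graph on `{0, …, n - 1}` with head `H` and adjacency `adj`. -/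
structure Describes (n : ℕ) (H : Finset ℕ) (adj : ℕ → ℕ → Prop) (inp : ℕ → ℕ) : Prop where
  size : inp 0 = n
  head : ∀ v < n, (0 < inp (v + 1) ↔ v ∈ H)
  edge : ∀ u < n, ∀ v < n, (0 < inp (1 + n + u * n + v) ↔ adj u v)
  subset : H ⊆ Finset.range n

theorem Describes.lt {n : ℕ} {H : Finset ℕ} {adj : ℕ → ℕ → Prop} {inp : ℕ → ℕ}
    (h : Describes n H adj inp) {v : ℕ} (hv : v ∈ H) : v < n := Finset.mem_range.1 (h.subset hv)

/-- Registers `0`, `1`, `2` hold the constants `0`, `n`, `1`, and array `0` holds the input. -/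
structure Std (n : ℕ) (inp : ℕ → ℕ) (s : St) : Prop where
  zero : s.reg 0 = 0
  size : s.reg 1 = n
  one : s.reg 2 = 1
  input : s.arr 0 = inp

/-- The command changes neither the constants nor the input. -/
def Keeps (c : Cmd) : Prop := 0 ∉ c.regs ∧ 1 ∉ c.regs ∧ 2 ∉ c.regs ∧ 0 ∉ c.arrs

instance (c : Cmd) : Decidable (Keeps c) := by unfold Keeps; infer_instance

theorem Std.frame {n : ℕ} {inp : ℕ → ℕ} {s s' : St} {c : Cmd} (h : Std n inp s)
    (hf : Frame c s s') (hc : Keeps c) : Std n inp s' :=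
  ⟨(hf.reg 0 hc.1).trans h.zero, (hf.reg 1 hc.2.1).trans h.size,
    (hf.reg 2 hc.2.2.1).trans h.one, (hf.arr 0 hc.2.2.2).trans h.input⟩

theorem Std.den {n : ℕ} {inp : ℕ → ℕ} {s : St} (h : Std n inp s) (c : Cmd) (hc : Keeps c) :
    Std n inp (c.den s) :=
  h.frame (frame_den c s) hc

theorem Std.set {n : ℕ} {inp : ℕ → ℕ} {s : St} (h : Std n inp s) {x v : ℕ} (hx : 2 < x) :
    Std n inp (s.set x v) := by
  constructor
  · rw [St.set_reg, if_neg (by omega), h.zero]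
  · rw [St.set_reg, if_neg (by omega), h.size]
  · rw [St.set_reg, if_neg (by omega), h.one]
  · exact h.input

/-- Register `12` gets the head bit of the vertex in register `x`. -/
def headC (x : ℕ) : Cmd := block [copy 13 x, inc 13, load 12 0 13]

theorem headC_spec (x : ℕ) (s : St) : ((headC x).den s).reg 12 = s.arr 0 (s.reg x + 1) := by
  simp [headC, block, Cmd.den]

/-- Register `12` gets the adjacency bit of the vertices in registers `10` and `11`. -/
def adjC : Cmd :=
  block [const 13 1, loop 14 (inc 13), loop 14 (ifLt 14 10 (loop 15 (inc 13)) skip),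
    loop 14 (ifLt 14 11 (inc 13) skip), load 12 0 13]

theorem loop_inc {x y : ℕ} (hxy : x ≠ y) (s : St) :
    ((loop x (inc y)).den s).reg y = s.reg y + s.reg 1 := by
  refine loop_induction (I := fun i s' => s'.reg y = s.reg y + i) ?_ ?_
  · simp [hxy.symm]
  · intro i _ s' _ _ h
    simp [Cmd.den, hxy.symm, h]
    omega

/-- The row-major index is built from increments alone. The loops always run `n` rounds, so the
guards count to the minimum of `n` and the coordinate; the two hypotheses make this the coordinate
itself. -/
theorem adjC_spec (s : St) (hu : s.reg 10 ≤ s.reg 1) (hv : s.reg 11 ≤ s.reg 1) :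
    (adjC.den s).reg 12 = s.arr 0 (1 + s.reg 1 + s.reg 10 * s.reg 1 + s.reg 11) := by
  set s1 := (const 13 1).den s with h1
  set s2 := (loop 14 (inc 13)).den s1 with h2
  set s3 := (loop 14 (ifLt 14 10 (loop 15 (inc 13)) skip)).den s2 with h3
  set s4 := (loop 14 (ifLt 14 11 (inc 13) skip)).den s3 with h4
  have e : (adjC.den s) = s4.set 12 (s4.arr 0 (s4.reg 13)) := rfl
  have r1 : s1.reg 13 = 1 ∧ s1.reg 1 = s.reg 1 ∧ s1.reg 10 = s.reg 10 ∧ s1.reg 11 = s.reg 11 := by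
    simp [h1, Cmd.den]
  have r2 : s2.reg 13 = 1 + s.reg 1 ∧ s2.reg 1 = s.reg 1 ∧ s2.reg 10 = s.reg 10 ∧
      s2.reg 11 = s.reg 11 := by
    refine ⟨?_, ?_, ?_, ?_⟩
    · rw [h2, loop_inc (by decide), r1.1, r1.2.1]
    all_goals rw [h2, den_reg (by decide)]; simp [r1]
  have r3 : s3.reg 13 = 1 + s.reg 1 + s.reg 10 * s.reg 1 ∧ s3.reg 1 = s.reg 1 ∧
      s3.reg 11 = s.reg 11 := by
    refine ⟨?_, ?_, ?_⟩
    · have := loop_induction (x := 14) (p := ifLt 14 10 (loop 15 (inc 13)) skip) (s := s2)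
        (I := fun i s' => s'.reg 13 = s2.reg 13 + min i (s.reg 10) * s.reg 1) (by simp) (by
          intro i hi s' hf hx h
          have f1 : s'.reg 1 = s.reg 1 := (hf.reg 1 (by decide)).trans r2.2.1
          have f10 : s'.reg 10 = s.reg 10 := (hf.reg 10 (by decide)).trans r2.2.2.1
          simp only [Cmd.den, hx, f10, St.set_reg]
          by_cases hc : i < s.reg 10
          · have := loop_inc (x := 15) (y := 13) (by decide) s'
            simp only [Cmd.den] at this
            rw [if_pos hc, if_neg (by decide), this, h, f1, min_eq_left hc.le,
              min_eq_left hc, Nat.succ_mul]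
            omega
          · rw [if_neg hc, if_neg (by decide), h, min_eq_right (by omega),
              min_eq_right (by omega)])
      rw [← h3, r2.1, r2.2.1, min_eq_right hu] at this
      exact this
    all_goals rw [h3, den_reg (by decide)]; simp [r2]
  have r4 : s4.reg 13 = 1 + s.reg 1 + s.reg 10 * s.reg 1 + s.reg 11 := by
    have := loop_induction (x := 14) (p := ifLt 14 11 (inc 13) skip) (s := s3)
      (I := fun i s' => s'.reg 13 = s3.reg 13 + min i (s.reg 11)) (by simp) (by
        intro i hi s' hf hx h
        have f11 : s'.reg 11 = s.reg 11 := (hf.reg 11 (by decide)).trans r3.2.2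
        simp only [Cmd.den, hx, f11, St.set_reg]
        by_cases hc : i < s.reg 11
        · simp [hc, h]
          omega
        · simp [hc, h]
          omega)
    rw [← h4, r3.1, r3.2.1, min_eq_right hv] at this
    exact this
  have a4 : s4.arr 0 = s.arr 0 := by
    rw [h4, den_arr (by decide), h3, den_arr (by decide), h2, den_arr (by decide), h1]
    rfl
  rw [e, St.set_reg, if_pos rfl, r4, a4]

section Specs

variable {n : ℕ} {H : Finset ℕ} {adj : ℕ → ℕ → Prop} {inp : ℕ → ℕ}

theorem headC_pos (hd : Describes n H adj inp) {s : St} (hs : Std n inp s) {x v : ℕ}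
    (hx : s.reg x = v) (hv : v < n) : s.reg 0 < ((headC x).den s).reg 12 ↔ v ∈ H := by
  rw [headC_spec, hs.input, hx, hs.zero]
  exact hd.head v hv

theorem adjC_pos (hd : Describes n H adj inp) {s : St} (hs : Std n inp s) {u v : ℕ}
    (hu : s.reg 10 = u) (hv : s.reg 11 = v) (hun : u < n) (hvn : v < n) :
    s.reg 0 < (adjC.den s).reg 12 ↔ adj u v := by
  rw [adjC_spec s (by rw [hu, hs.size]; exact hun.le) (by rw [hv, hs.size]; exact hvn.le),
    hs.input, hu, hv, hs.zero, hs.size]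
  exact hd.edge u hun v hvn

/-- The set of the positions below `n` with a positive entry. -/
def pos (n : ℕ) (b : ℕ → ℕ) : Finset ℕ := (Finset.range n).filter (0 < b ·)

@[simp] theorem mem_pos {n : ℕ} {b : ℕ → ℕ} {v : ℕ} : v ∈ pos n b ↔ v < n ∧ 0 < b v := by
  simp [pos]

/-! ### Closing a set under forcing -/

/-- Mark the vertex in register `22` if it is forced by the one in register `21`. -/
def edgeC : Cmd :=
  block [headC 22, ifLt 0 12 (block [copy 10 21, load 11 3 22, adjC,
    ifLt 0 12 (store 2 22 2) skip]) skip]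

theorem edgeC_spec (hd : Describes n H adj inp) {s : St} (hs : Std n inp s)
    (hm : IsMate n H adj (s.arr 3)) {u v : ℕ} (hu : s.reg 21 = u) (hv : s.reg 22 = v)
    (hun : u < n) (hvn : v < n) (x : ℕ) :
    0 < (edgeC.den s).arr 2 x ↔ 0 < s.arr 2 x ∨ (x = v ∧ Forces H adj (s.arr 3) u v) := by
  set s1 := (headC 22).den s with h1
  have hs1 : Std n inp s1 := hs.den _ (by decide)
  have hh : s1.reg 0 < s1.reg 12 ↔ v ∈ H := by
    rw [hs1.zero, ← hs.zero]; exact headC_pos hd hs hv hvn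
  have a1 : s1.arr = s.arr := by
    rw [h1]; simp [headC, block, Cmd.den]
  set s2 := (s1.set 10 (s1.reg 21)).set 11 (s1.arr 3 (s1.reg 22)) with h2
  have hs2 : Std n inp s2 := (hs1.set (by decide)).set (by decide)
  have hu2 : s2.reg 10 = u := by
    simp only [h2, St.set_reg]
    rw [if_neg (by decide), if_pos trivial, h1, den_reg (by decide), hu]
  have hv2 : s2.reg 11 = s.arr 3 v := by
    simp only [h2, St.set_reg]
    rw [if_pos trivial, a1, h1, den_reg (by decide), hv]
  set s3 := adjC.den s2 with h3
  have e : edgeC.den s = if s1.reg 0 < s1.reg 12 then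
      (if s3.reg 0 < s3.reg 12 then s3.put 2 (s3.reg 22) (s3.reg 2) else s3) else s1 := by
    simp [edgeC, block, Cmd.den, h3, h2, h1]
  have hs3 : Std n inp s3 := hs2.den _ (by decide)
  have a3 : s3.arr 2 = s.arr 2 := by
    rw [h3, den_arr (by decide), h2, St.set_arr, St.set_arr, a1]
  have v3 : s3.reg 22 = v := by
    rw [h3, den_reg (by decide), h2]
    simp only [St.set_reg]
    rw [if_neg (by decide), if_neg (by decide), h1, den_reg (by decide), hv]
  rw [e, Forces]
  by_cases hvH : v ∈ H
  · have ha : s3.reg 0 < s3.reg 12 ↔ adj u (s.arr 3 v) := by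
      rw [hs3.zero, ← hs2.zero]; exact adjC_pos hd hs2 hu2 hv2 hun (hm.head v hvH).1
    rw [if_pos (hh.2 hvH)]
    by_cases hadj : adj u (s.arr 3 v)
    · rw [if_pos (ha.2 hadj), St.put_arr, if_pos rfl, v3, hs3.one, a3]
      by_cases hx : x = v <;> simp [hx, hvH, hadj]
    · rw [if_neg (ha.not.2 hadj), a3]
      simp [hadj]
  · rw [if_neg (hh.not.2 hvH), a1]
    simp [hvH]

/-- Mark all vertices that are forced by the vertex in register `21`, if that one is marked. -/
def forceC : Cmd := block [load 16 2 21, ifLt 0 16 (loop 22 edgeC) skip]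

theorem forceC_spec (hd : Describes n H adj inp) {s : St} (hs : Std n inp s)
    (hm : IsMate n H adj (s.arr 3)) {u : ℕ} (hu : s.reg 21 = u) (hun : u < n) (x : ℕ) :
    x ∈ pos n ((forceC.den s).arr 2) ↔
      x ∈ pos n (s.arr 2) ∨ (u ∈ pos n (s.arr 2) ∧ Forces H adj (s.arr 3) u x) := by
  set s1 := s.set 16 (s.arr 2 u) with h1
  have hs1 : Std n inp s1 := hs.set (by decide)
  have e : forceC.den s = if 0 < s.arr 2 u then (loop 22 edgeC).den s1 else s1 := by
    simp [forceC, block, Cmd.den, h1, hu, hs.zero]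
  have key := loop_induction (x := 22) (p := edgeC) (s := s1)
    (I := fun i s' => ∀ x, 0 < s'.arr 2 x ↔
      0 < s.arr 2 x ∨ (x < i ∧ Forces H adj (s.arr 3) u x)) (by simp [h1]) (by
      intro i hi s' hf hx h y
      have hs' : Std n inp s' := hs1.frame hf (by decide)
      have a3 : s'.arr 3 = s.arr 3 := hf.arr 3 (by decide)
      have u' : s'.reg 21 = u := (hf.reg 21 (by decide)).trans (by simp [h1, hu])
      rw [hs1.size] at hi
      rw [St.set_arr, edgeC_spec hd hs' (a3 ▸ hm) u' hx hun hi, h, a3]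
      constructor
      · rintro ((h | h) | ⟨rfl, h⟩)
        · exact Or.inl h
        · exact Or.inr ⟨by omega, h.2⟩
        · exact Or.inr ⟨by omega, h⟩
      · rintro (h | ⟨h, h'⟩)
        · exact Or.inl (Or.inl h)
        · rcases Nat.lt_succ_iff_lt_or_eq.1 h with h | rfl
          · exact Or.inl (Or.inr ⟨h, h'⟩)
          · exact Or.inr ⟨rfl, h'⟩)
  rw [hs1.size] at key
  rw [e, mem_pos, mem_pos, mem_pos]
  by_cases h0 : 0 < s.arr 2 u
  · rw [if_pos h0, key]
    have : Forces H adj (s.arr 3) u x → x < n := fun h => hd.lt h.1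
    tauto
  · simp [h0, h1]

/-- Close the set in array `2`. -/
def closeC : Cmd := loop 20 (loop 21 forceC)

/-- A round leads from `B` to `B'`. -/
structure ClosureRound (E : ℕ → ℕ → Prop) (B B' : Finset ℕ) : Prop where
  subset : B ⊆ B'
  forced : ∀ u ∈ B, ∀ v, E u v → v ∈ B'
  least : ∀ D, B ⊆ D → ClosedUnder E D → B' ⊆ D

/-- A vertex marked during the sweep may force others later in the same sweep, so the result depends
on the order of the vertices. Only bounds from below and above are recorded, and they suffice. -/
theorem closureRound_spec (hd : Describes n H adj inp) {s : St} (hs : Std n inp s)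
    (hm : IsMate n H adj (s.arr 3)) :
    ClosureRound (Forces H adj (s.arr 3)) (pos n (s.arr 2))
      (pos n (((loop 21 forceC).den s).arr 2)) := by
  have key := loop_induction (x := 21) (p := forceC) (s := s)
    (I := fun i s' => pos n (s.arr 2) ⊆ pos n (s'.arr 2) ∧
      (∀ u ∈ pos n (s.arr 2), u < i → ∀ v, Forces H adj (s.arr 3) u v → v ∈ pos n (s'.arr 2)) ∧
      ∀ D, pos n (s.arr 2) ⊆ D → ClosedUnder (Forces H adj (s.arr 3)) D → pos n (s'.arr 2) ⊆ D)
    ⟨by simp, by simp, fun D h _ => by simpa using h⟩ (by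
      intro i hi s' hf hx ⟨h1, h2, h3⟩
      have hs' : Std n inp s' := hs.frame hf (by decide)
      have a3 : s'.arr 3 = s.arr 3 := hf.arr 3 (by decide)
      rw [hs.size] at hi
      have sp := forceC_spec hd hs' (a3 ▸ hm) hx hi
      rw [a3] at sp
      rw [St.set_arr]
      refine ⟨fun x hx => (sp x).2 (Or.inl (h1 hx)), fun u hu hui v huv => (sp v).2 ?_,
        fun D hD hcl x hx => ?_⟩
      · rcases Nat.lt_succ_iff_lt_or_eq.1 hui with hui | rfl
        · exact Or.inl (h2 u hu hui v huv)
        · exact Or.inr ⟨h1 hu, huv⟩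
      · rcases (sp x).1 hx with hx | ⟨hi, hx⟩
        · exact h3 D hD hcl hx
        · exact hcl _ (h3 D hD hcl hi) _ hx)
  rw [hs.size] at key
  exact ⟨key.1, fun u hu => key.2.1 u hu (mem_pos.1 hu).1, key.2.2⟩

/-- A sweep that changes nothing certifies closedness, and any other sweep adds a vertex. After `n`
sweeps the set is closed or it is all of `{0, …, n - 1}`, which is closed as well. -/
theorem closeC_spec (hd : Describes n H adj inp) {s : St} (hs : Std n inp s)
    (hm : IsMate n H adj (s.arr 3)) :
    IsClosureOf (Forces H adj (s.arr 3)) (pos n (s.arr 2)) (pos n ((closeC.den s).arr 2)) := by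
  have hE : ∀ u v, Forces H adj (s.arr 3) u v → v < n := fun u v h => hd.lt h.1
  generalize hEE : Forces H adj (s.arr 3) = E at *
  have key := loop_induction (x := 20) (p := loop 21 forceC) (s := s)
    (I := fun i s' => pos n (s.arr 2) ⊆ pos n (s'.arr 2) ∧
      (ClosedUnder E (pos n (s'.arr 2)) ∨ i ≤ (pos n (s'.arr 2)).card) ∧
      ∀ D, pos n (s.arr 2) ⊆ D → ClosedUnder E D → pos n (s'.arr 2) ⊆ D)
    ⟨by simp, by simp, fun D h _ => by simpa using h⟩ (by
      intro i hi s' hf hx ⟨h1, h2, h3⟩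
      have hs' : Std n inp s' := hs.frame hf (by decide)
      have a3 : s'.arr 3 = s.arr 3 := hf.arr 3 (by decide)
      have sp := closureRound_spec hd hs' (a3 ▸ hm)
      rw [a3, hEE] at sp
      rw [St.set_arr]
      set B := pos n (s'.arr 2)
      set B' := pos n (((loop 21 forceC).den s').arr 2)
      refine ⟨h1.trans sp.subset, ?_, fun D hD hcl => sp.least D (h3 D hD hcl) hcl⟩
      by_cases hBB : B' = B
      · left
        rw [hBB]
        intro u hu v huv
        exact hBB ▸ sp.forced u hu v huv
      · rcases h2 with h2 | h2
        · exact absurd ((sp.least B le_rfl h2).antisymm sp.subset) hBB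
        · right
          have := Finset.card_lt_card (Finset.ssubset_iff_subset_ne.2 ⟨sp.subset, Ne.symm hBB⟩)
          omega)
  rw [hs.size] at key
  refine ⟨key.1, ?_, key.2.2⟩
  rcases key.2.1 with h | h
  · exact h
  · have : pos n ((closeC.den s).arr 2) = Finset.range n := by
      refine Finset.eq_of_subset_of_card_le (Finset.filter_subset _ _) ?_
      rw [Finset.card_range]
      exact h
    rw [this]
    intro u _ v huv
    exact Finset.mem_range.2 (hE u v huv)

end Specs

end EnumRAM
namespace EnumRAM

open Cmd

/-! ### The successor of a closed set -/

/-- The candidate for the successor at the position in register `30`, before closing it. -/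
def candC : Cmd :=
  block [loop 20 (block [const 16 0, ifLt 30 20 (load 16 1 20) skip, store 2 20 16]),
    store 2 30 2]

/-- Compare the set in array `2` with the one in array `1` at the position in register `20`. -/
def aboveC : Cmd := block [load 16 1 20, ifLt 30 20 (ifLt 0 16 skip (const 31 0)) skip]

/-- Look for an edge from register `20` to register `21` in the set in array `2`. -/
def pairC : Cmd :=
  block [load 16 2 21, ifLt 0 16 (block [copy 10 20, copy 11 21, adjC,
    ifLt 0 12 (const 31 0) skip]) skip]

/-- All tests for the vertex in register `20`. -/
def rowC : Cmd := block [load 16 2 20, ifLt 0 16 (seq aboveC (loop 21 pairC)) skip]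

/-- Test the admissibility of the set in array `2`. -/
def checkC : Cmd := block [const 31 1, loop 20 rowC]

/-- Copy array `2` to array `1`. -/
def copyC : Cmd := loop 20 (block [load 16 2 20, store 1 20 16])

/-- Try to find the successor at the position in register `30`. -/
def tryC : Cmd := block [candC, closeC, checkC, ifLt 0 31 (block [copyC, const 3 1]) skip]

/-- One round of the search for the successor. -/
def scanC : Cmd :=
  ifLt 3 2 (block [load 16 1 30, ifLt 0 16 skip (block [headC 30, ifLt 0 12 tryC skip])]) skip

/-- Replace the set in array `1` by its successor; register `3` tells whether there is one. -/
def nextC : Cmd := block [const 3 0, loop 30 scanC]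

section Specs

variable {n : ℕ} {H : Finset ℕ} {adj : ℕ → ℕ → Prop} {inp : ℕ → ℕ}

theorem candC_spec {s : St} (hs : Std n inp s) {i : ℕ} (hi : s.reg 30 = i) (hin : i < n) :
    pos n ((candC.den s).arr 2) = raise (pos n (s.arr 1)) i := by
  set b := block [const 16 0, ifLt 30 20 (load 16 1 20) skip, store 2 20 16] with hb
  have key := loop_induction (x := 20) (p := b) (s := s)
    (I := fun j s' => ∀ x < j, (0 < s'.arr 2 x ↔ i < x ∧ 0 < s.arr 1 x)) (by simp) (by
      intro j hj s' hf hx h y hy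
      have i' : s'.reg 30 = i := (hf.reg 30 (by decide)).trans hi
      have a1 : s'.arr 1 = s.arr 1 := hf.arr 1 (by decide)
      rw [hs.size] at hj
      have e : (b.den s').arr 2 = Function.update (s'.arr 2) j
          (if i < j then s.arr 1 j else 0) := by
        by_cases hij : i < j <;> simp [hb, block, Cmd.den, hx, i', hij, a1]
      rw [St.set_arr, e, Function.update_apply]
      by_cases hyj : y = j
      · subst hyj
        by_cases hij : i < y <;> simp [hij]
      · rw [if_neg hyj]
        exact h y (by omega))
  rw [hs.size] at key
  set s1 := (loop 20 b).den s with h1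
  have e : candC.den s = s1.put 2 (s1.reg 30) (s1.reg 2) := rfl
  have i1 : s1.reg 30 = i := by rw [h1, den_reg (by decide), hi]
  have o1 : s1.reg 2 = 1 := (hs.den (loop 20 b) (by decide)).one
  ext x
  rw [e, St.put_arr, if_pos rfl, i1, o1, mem_pos, Function.update_apply, raise,
    Finset.mem_insert, Finset.mem_filter, mem_pos]
  by_cases hx : x = i
  · simp [hx, hin]
  · simp only [hx, if_false, false_or]
    constructor
    · rintro ⟨h, h'⟩
      have := (key x h).1 h'
      tauto
    · rintro ⟨⟨h, h'⟩, h''⟩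
      exact ⟨h, (key x h).2 ⟨h'', h'⟩⟩

theorem pairC_spec (hd : Describes n H adj inp) {s : St} (hs : Std n inp s) {u v : ℕ}
    (hu : s.reg 20 = u) (hv : s.reg 21 = v) (hun : u < n) (hvn : v < n) :
    0 < (pairC.den s).reg 31 ↔ 0 < s.reg 31 ∧ ¬ (v ∈ pos n (s.arr 2) ∧ adj u v) := by
  set s1 := ((s.set 16 (s.arr 2 v)).set 10 u).set 11 v with h1
  have hs1 : Std n inp s1 := ((hs.set (by decide)).set (by decide)).set (by decide)
  set s2 := adjC.den s1 with h2
  have hs2 : Std n inp s2 := hs1.den _ (by decide)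
  have e : pairC.den s = if 0 < s.arr 2 v then
      (if s2.reg 0 < s2.reg 12 then s2.set 31 0 else s2) else s.set 16 (s.arr 2 v) := by
    simp [pairC, block, Cmd.den, h2, h1, hu, hv, hs.zero]
  have ha : s2.reg 0 < s2.reg 12 ↔ adj u v := by
    rw [hs2.zero, ← hs1.zero]
    exact adjC_pos hd hs1 (by simp [h1]) (by simp [h1]) hun hvn
  have r2 : s2.reg 31 = s.reg 31 := by
    rw [h2, den_reg (by decide), h1]; simp
  rw [e, mem_pos]
  by_cases hb : 0 < s.arr 2 v
  · by_cases hadj : adj u v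
    · simp [hb, ha.2 hadj, hvn, hadj]
    · rw [if_pos hb, if_neg (ha.not.2 hadj), r2]
      simp [hadj]
  · simp [hb]

theorem rowC_spec (hd : Describes n H adj inp) {s : St} (hs : Std n inp s) {u i : ℕ}
    (hu : s.reg 20 = u) (hi : s.reg 30 = i) (hun : u < n) :
    0 < (rowC.den s).reg 31 ↔ 0 < s.reg 31 ∧ (u ∈ pos n (s.arr 2) →
      (i < u → u ∈ pos n (s.arr 1)) ∧ ∀ v ∈ pos n (s.arr 2), ¬ adj u v) := by
  set s1 := s.set 16 (s.arr 2 u) with h1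
  set s2 := aboveC.den s1 with h2
  have hs2 : Std n inp s2 := (hs.set (by decide)).den _ (by decide)
  have e : rowC.den s = if 0 < s.arr 2 u then (loop 21 pairC).den s2 else s1 := by
    simp [rowC, block, Cmd.den, h2, h1, hu, hs.zero]
  have a2 : s2.arr = s.arr := by
    funext k
    rw [h2, den_arr (by simp [aboveC, block, arrs]), h1, St.set_arr]
  have u2 : s2.reg 20 = u := by
    rw [h2, den_reg (by decide), h1]; simp [hu]
  have r2 : 0 < s2.reg 31 ↔ 0 < s.reg 31 ∧ (i < u → 0 < s.arr 1 u) := by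
    have : s2 = if i < u then (if 0 < s.arr 1 u then s1.set 16 (s.arr 1 u) else
        (s1.set 16 (s.arr 1 u)).set 31 0) else s1.set 16 (s.arr 1 u) := by
      simp [h2, aboveC, block, Cmd.den, h1, hu, hi, hs.zero]
    rw [this]
    by_cases hiu : i < u <;> by_cases ha : 0 < s.arr 1 u <;> simp [hiu, ha, h1]
  have key := loop_induction (x := 21) (p := pairC) (s := s2)
    (I := fun j s' => 0 < s'.reg 31 ↔ 0 < s2.reg 31 ∧
      ∀ v ∈ pos n (s.arr 2), v < j → ¬ adj u v) (by simp) (by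
      intro j hj s' hf hx h
      have hs' : Std n inp s' := hs2.frame hf (by decide)
      have u' : s'.reg 20 = u := (hf.reg 20 (by decide)).trans u2
      have b' : s'.arr 2 = s.arr 2 := (hf.arr 2 (by decide)).trans (by rw [a2])
      rw [hs2.size] at hj
      rw [St.set_reg, if_neg (by decide), pairC_spec hd hs' u' hx hun hj, h, b']
      constructor
      · rintro ⟨⟨h1, h2⟩, h3⟩
        refine ⟨h1, fun v hv hvj hadj => ?_⟩
        rcases Nat.lt_succ_iff_lt_or_eq.1 hvj with hvj | rfl
        · exact h2 v hv hvj hadj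
        · exact h3 ⟨hv, hadj⟩
      · rintro ⟨h1, h2⟩
        exact ⟨⟨h1, fun v hv hvj => h2 v hv (by omega)⟩, fun h => h2 j h.1 (by omega) h.2⟩)
  rw [hs2.size] at key
  rw [e, mem_pos, mem_pos]
  by_cases hb : 0 < s.arr 2 u
  · rw [if_pos hb, key, r2]
    have : (∀ v ∈ pos n (s.arr 2), v < n → ¬ adj u v) ↔ ∀ v ∈ pos n (s.arr 2), ¬ adj u v :=
      ⟨fun h v hv => h v hv (mem_pos.1 hv).1, fun h v hv _ => h v hv⟩
    rw [this]
    tauto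
  · simp [hb, h1]

theorem checkC_spec (hd : Describes n H adj inp) {s : St} (hs : Std n inp s) {i : ℕ}
    (hi : s.reg 30 = i) :
    0 < (checkC.den s).reg 31 ↔ (∀ u ∈ pos n (s.arr 2), i < u → u ∈ pos n (s.arr 1)) ∧
      ∀ u ∈ pos n (s.arr 2), ∀ v ∈ pos n (s.arr 2), ¬ adj u v := by
  have key := loop_induction (x := 20) (p := rowC) (s := s.set 31 1)
    (I := fun j s' => 0 < s'.reg 31 ↔ ∀ u ∈ pos n (s.arr 2), u < j →
      (i < u → u ∈ pos n (s.arr 1)) ∧ ∀ v ∈ pos n (s.arr 2), ¬ adj u v) (by simp) (by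
      intro j hj s' hf hx h
      have hs' : Std n inp s' := (hs.set (by decide)).frame hf (by decide)
      have i' : s'.reg 30 = i := (hf.reg 30 (by decide)).trans (by simp [hi])
      have a1 : s'.arr 1 = s.arr 1 := hf.arr 1 (by decide)
      have a2 : s'.arr 2 = s.arr 2 := hf.arr 2 (by decide)
      rw [(hs.set (by decide)).size] at hj
      rw [St.set_reg, if_neg (by decide), rowC_spec hd hs' hx i' hj, h, a1, a2]
      constructor
      · rintro ⟨h1, h2⟩ u hu huj
        rcases Nat.lt_succ_iff_lt_or_eq.1 huj with huj | rfl
        · exact h1 u hu huj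
        · exact h2 hu
      · intro h1
        exact ⟨fun u hu huj => h1 u hu (by omega), fun hj => h1 j hj (by omega)⟩)
  rw [(hs.set (by decide)).size] at key
  have e : checkC.den s = (loop 20 rowC).den (s.set 31 1) := rfl
  rw [e, key]
  constructor
  · intro h
    exact ⟨fun u hu => (h u hu (mem_pos.1 hu).1).1, fun u hu => (h u hu (mem_pos.1 hu).1).2⟩
  · rintro ⟨h1, h2⟩ u hu _
    exact ⟨h1 u hu, h2 u hu⟩

theorem copyC_spec {s : St} (hs : Std n inp s) :
    pos n ((copyC.den s).arr 1) = pos n (s.arr 2) := by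
  set b := block [load 16 2 20, store 1 20 16] with hb
  have key := loop_induction (x := 20) (p := b) (s := s)
    (I := fun j s' => ∀ x < j, s'.arr 1 x = s.arr 2 x) (by simp) (by
      intro j hj s' hf hx h y hy
      have a2 : s'.arr 2 = s.arr 2 := hf.arr 2 (by decide)
      have e : (b.den s').arr 1 = Function.update (s'.arr 1) j (s.arr 2 j) := by
        simp [hb, block, Cmd.den, hx, a2]
      rw [St.set_arr, e, Function.update_apply]
      by_cases hyj : y = j
      · simp [hyj]
      · rw [if_neg hyj]
        exact h y (by omega))
  rw [hs.size] at key
  ext x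
  rw [mem_pos, mem_pos]
  have : ∀ h : x < n, (copyC.den s).arr 1 x = s.arr 2 x := key x
  constructor <;> rintro ⟨h, h'⟩
  · exact ⟨h, this h ▸ h'⟩
  · exact ⟨h, (this h).symm ▸ h'⟩

/-- The candidate for the successor of `A` at `i`. -/
noncomputable def candidate (H : Finset ℕ) (adj : ℕ → ℕ → Prop) (mt : ℕ → ℕ) (A : Finset ℕ)
    (i : ℕ) : Finset ℕ :=
  leastClosed H (Forces H adj mt) (raise A i)

theorem tryC_spec (hd : Describes n H adj inp) {s : St} (hs : Std n inp s)
    (hm : IsMate n H adj (s.arr 3)) {i : ℕ} (hi : s.reg 30 = i) (hin : i < n) {A : Finset ℕ}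
    (hA : pos n (s.arr 1) = A) (hiH : i ∈ H) (hiA : i ∉ A) :
    (Admissible H adj A i (candidate H adj (s.arr 3) A i) ∧ (tryC.den s).reg 3 = 1 ∧
      pos n ((tryC.den s).arr 1) = candidate H adj (s.arr 3) A i) ∨
    (¬ Admissible H adj A i (candidate H adj (s.arr 3) A i) ∧ (tryC.den s).reg 3 = s.reg 3 ∧
      pos n ((tryC.den s).arr 1) = A) := by
  set s1 := candC.den s with h1
  set s2 := closeC.den s1 with h2
  set s3 := checkC.den s2 with h3
  have e : tryC.den s = if s3.reg 0 < s3.reg 31 then (copyC.den s3).set 3 1 else s3 := by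
    simp [tryC, block, Cmd.den, h3, h2, h1]
  have hs1 : Std n inp s1 := hs.den _ (by decide)
  have hs2 : Std n inp s2 := hs1.den _ (by decide)
  have hs3 : Std n inp s3 := hs2.den _ (by decide)
  have m1 : s1.arr 3 = s.arr 3 := by rw [h1, den_arr (by decide)]
  have i2 : s2.reg 30 = i := by rw [h2, den_reg (by decide), h1, den_reg (by decide), hi]
  have A2 : pos n (s2.arr 1) = A := by rw [h2, den_arr (by decide), h1, den_arr (by decide), hA]
  have A3 : pos n (s3.arr 1) = A := by rw [h3, den_arr (by decide), A2]
  have B2 : pos n (s2.arr 2) = candidate H adj (s.arr 3) A i := by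
    have := closeC_spec hd hs1 (m1 ▸ hm)
    rw [candC_spec hs hi hin, m1, hA] at this
    exact this.eq_leastClosed fun u v h => h.1
  have B3 : pos n (s3.arr 2) = candidate H adj (s.arr 3) A i := by
    rw [h3, den_arr (by decide), B2]
  have ck := checkC_spec hd hs2 i2
  rw [← h3, A2, B2] at ck
  have hadm : Admissible H adj A i (candidate H adj (s.arr 3) A i) ↔ 0 < s3.reg 31 := by
    rw [ck]
    exact ⟨fun h => ⟨h.agree, h.indep⟩, fun h => ⟨hiH, hiA, h.1, h.2⟩⟩
  rw [e, hs3.zero, hadm]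
  by_cases hk : 0 < s3.reg 31
  · left
    rw [if_pos hk]
    exact ⟨hk, by simp, by rw [St.set_arr, copyC_spec hs3, B3]⟩
  · right
    rw [if_neg hk]
    refine ⟨hk, ?_, A3⟩
    rw [h3, den_reg (by decide), h2, den_reg (by decide), h1, den_reg (by decide)]

/-- Positions are tried in increasing order and the search stops acting after the first success, so
the position found is the least admissible one. The set in array `1` is intact until then. -/
theorem nextC_spec (hd : Describes n H adj inp) {s : St} (hs : Std n inp s)
    (hm : IsMate n H adj (s.arr 3)) {A : Finset ℕ} (hA : pos n (s.arr 1) = A) :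
    ((nextC.den s).reg 3 = 1 ∧ ∃ i, Admissible H adj A i (candidate H adj (s.arr 3) A i) ∧
      (∀ j < i, ¬ Admissible H adj A j (candidate H adj (s.arr 3) A j)) ∧
      pos n ((nextC.den s).arr 1) = candidate H adj (s.arr 3) A i) ∨
    ((nextC.den s).reg 3 = 0 ∧
      ∀ j, ¬ Admissible H adj A j (candidate H adj (s.arr 3) A j)) := by
  have key := loop_induction (x := 30) (p := scanC) (s := s.set 3 0)
    (I := fun k s' => (s'.reg 3 = 1 ∧
      ∃ i, Admissible H adj A i (candidate H adj (s.arr 3) A i) ∧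
      (∀ j < i, ¬ Admissible H adj A j (candidate H adj (s.arr 3) A j)) ∧
      pos n (s'.arr 1) = candidate H adj (s.arr 3) A i) ∨
    (s'.reg 3 = 0 ∧ pos n (s'.arr 1) = A ∧
      ∀ j < k, ¬ Admissible H adj A j (candidate H adj (s.arr 3) A j)))
    (Or.inr ⟨by simp, hA, by simp⟩) (by
      intro i hi s' hf hx h
      have hs' : Std n inp s' := (hs.set (by decide)).frame hf (by decide)
      have m' : s'.arr 3 = s.arr 3 := hf.arr 3 (by decide)
      rw [(hs.set (by decide)).size] at hi
      rw [St.set_reg, if_neg (by decide), St.set_arr]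
      rcases h with ⟨h1, h2⟩ | ⟨h1, hA', h2⟩
      · left
        have e : scanC.den s' = s' := by simp [scanC, Cmd.den, h1, hs'.one]
        rw [e]
        exact ⟨h1, h2⟩
      · set s1 := s'.set 16 (s'.arr 1 i) with e1
        have hs1 : Std n inp s1 := hs'.set (by decide)
        set s2 := (headC 30).den s1 with e2
        have hs2 : Std n inp s2 := hs1.den _ (by decide)
        have e : scanC.den s' = if 0 < s'.arr 1 i then s1 else
            if s2.reg 0 < s2.reg 12 then tryC.den s2 else s2 := by
          simp [scanC, Cmd.den, block, h1, hs'.one, hs'.zero, hx, e1, e2]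
        have a2 : s2.arr = s'.arr := by
          rw [e2]; simp [headC, block, Cmd.den, e1]
        have hh : s2.reg 0 < s2.reg 12 ↔ i ∈ H := by
          rw [hs2.zero, ← hs1.zero]
          exact headC_pos hd hs1 (by simp [e1, hx]) hi
        have r2 : s2.reg 3 = 0 ∧ s2.reg 30 = i := by
          rw [e2, den_reg (by decide), den_reg (by decide), e1]
          simp [h1, hx]
        have hiA : i ∈ A ↔ 0 < s'.arr 1 i := by rw [← hA', mem_pos]; simp [hi]
        rw [e]
        by_cases hb : 0 < s'.arr 1 i
        · right
          rw [if_pos hb]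
          refine ⟨by simp [e1, h1], hA', fun j hj hadm => ?_⟩
          rcases Nat.lt_succ_iff_lt_or_eq.1 hj with hj | rfl
          · exact h2 j hj hadm
          · exact hadm.notMem (hiA.2 hb)
        · rw [if_neg hb]
          by_cases hiH : i ∈ H
          · rw [if_pos (hh.2 hiH)]
            have sp := tryC_spec hd hs2 (by rw [a2, m']; exact hm) r2.2 hi
              (by rw [a2]; exact hA') hiH (hiA.not.2 hb)
            rw [a2, m', r2.1] at sp
            rcases sp with ⟨s1, s2, s3⟩ | ⟨s1, s2, s3⟩
            · exact Or.inl ⟨s2, i, s1, h2, s3⟩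
            · refine Or.inr ⟨s2, s3, fun j hj hadm => ?_⟩
              rcases Nat.lt_succ_iff_lt_or_eq.1 hj with hj | rfl
              · exact h2 j hj hadm
              · exact s1 hadm
          · right
            rw [if_neg (hh.not.2 hiH)]
            refine ⟨r2.1, by rw [a2]; exact hA', fun j hj hadm => ?_⟩
            rcases Nat.lt_succ_iff_lt_or_eq.1 hj with hj | rfl
            · exact h2 j hj hadm
            · exact hiH hadm.mem)
  rw [(hs.set (by decide)).size] at key
  have e : nextC.den s = (loop 30 scanC).den (s.set 3 0) := rfl
  rw [e]
  rcases key with h | ⟨h1, -, h2⟩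
  · exact Or.inl h
  · exact Or.inr ⟨h1, fun j hadm => h2 j (hd.lt hadm.mem) hadm⟩

/-! ### Printing a cover -/

/-- Print the bit of the vertex in register `20`. -/
def bitC : Cmd :=
  block [headC 20, ifLt 0 12 (block [load 16 1 20, ifLt 0 16 (print 0) (print 2)])
    (block [load 17 3 20, load 16 1 17, ifLt 0 16 (print 2) (print 0)])]

/-- Print the cover that belongs to the set in array `1`. -/
def wordC : Cmd := loop 20 bitC

/-- The characteristic word of a set of numbers below `n`. -/
def natWord (n : ℕ) (S : Finset ℕ) : List ℕ := (List.range n).map fun v => if v ∈ S then 1 else 0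

theorem bitC_spec (hd : Describes n H adj inp) {s : St} (hs : Std n inp s)
    (hm : IsMate n H adj (s.arr 3)) {v : ℕ} (hv : s.reg 20 = v) (hvn : v < n) :
    (bitC.den s).buf =
      s.buf ++ [if v ∈ coverOf n H (s.arr 3) (pos n (s.arr 1)) then 1 else 0] := by
  set s1 := (headC 20).den s with h1
  have hs1 : Std n inp s1 := hs.den _ (by decide)
  have hh : s1.reg 0 < s1.reg 12 ↔ v ∈ H := by
    rw [hs1.zero, ← hs.zero]; exact headC_pos hd hs hv hvn
  have a1 : s1.arr = s.arr := by rw [h1]; simp [headC, block, Cmd.den]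
  have b1 : s1.buf = s.buf := by rw [h1, den_buf (by decide)]
  have v1 : s1.reg 20 = v := by rw [h1, den_reg (by decide), hv]
  have e : bitC.den s = if s1.reg 0 < s1.reg 12 then
      (block [load 16 1 20, ifLt 0 16 (print 0) (print 2)]).den s1 else
      (block [load 17 3 20, load 16 1 17, ifLt 0 16 (print 2) (print 0)]).den s1 := rfl
  rw [e]
  by_cases hvH : v ∈ H
  · rw [if_pos (hh.2 hvH)]
    by_cases hA : 0 < s.arr 1 v <;>
      simp [block, Cmd.den, coverOf, hvn, hvH, v1, a1, b1, hs1.zero, hs1.one, hA] <;> omega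
  · rw [if_neg (hh.not.2 hvH)]
    have hlt : s.arr 3 v < n := hd.lt (hm.crown v hvn hvH).1
    by_cases hA : 0 < s.arr 1 (s.arr 3 v) <;>
      simp [block, Cmd.den, coverOf, hvn, hvH, v1, a1, b1, hs1.zero, hs1.one, hA, hlt]

theorem wordC_spec (hd : Describes n H adj inp) {s : St} (hs : Std n inp s)
    (hm : IsMate n H adj (s.arr 3)) :
    (wordC.den s).buf =
      s.buf ++ natWord n (coverOf n H (s.arr 3) (pos n (s.arr 1))) := by
  have key := loop_induction (x := 20) (p := bitC) (s := s)
    (I := fun j s' => s'.buf = s.buf ++ (List.range j).map fun v =>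
      if v ∈ coverOf n H (s.arr 3) (pos n (s.arr 1)) then 1 else 0) (by simp) (by
      intro j hj s' hf hx h
      have hs' : Std n inp s' := hs.frame hf (by decide)
      have a1 : s'.arr 1 = s.arr 1 := hf.arr 1 (by decide)
      have a3 : s'.arr 3 = s.arr 3 := hf.arr 3 (by decide)
      rw [hs.size] at hj
      rw [St.set_buf, bitC_spec hd hs' (a3 ▸ hm) hx hj, h, a1, a3, List.range_succ,
        List.map_append, List.append_assoc]
      rfl)
  rw [hs.size] at key
  exact key

/-! ### Finding the matching -/

/-- Find the cheapest neighbour of the vertex in register `6`; it will be in register `7`, and its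
price in register `8`. -/
def bestC : Cmd :=
  block [copy 8 1, const 7 0, loop 9 (block [headC 9, ifLt 0 12 skip (block [copy 10 6, copy 11 9,
    adjC, ifLt 0 12 (block [load 16 4 9, ifLt 16 8 (block [copy 8 16, copy 7 9]) skip]) skip])])]

/-- Match the vertices in registers `6` and `7`. -/
def bidC : Cmd :=
  block [load 16 5 7, ifLt 0 16 (block [load 17 3 7, store 5 17 0]) skip, store 5 7 2,
    store 5 6 2, store 3 7 6, store 3 6 7, inc 8, store 4 7 8]

/-- Match the vertex in register `6` if it is an unmatched vertex of the head. -/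
def turnC : Cmd :=
  block [headC 6, ifLt 0 12 (block [load 16 5 6, ifLt 0 16 skip (seq bestC bidC)]) skip]

/-- Find a perfect matching. -/
def matchC : Cmd := loop 4 (loop 5 (loop 6 turnC))

/-- Register `8` starts at `n`, which plays the role of infinity; the hypothesis `hex` guarantees
that a real price replaces it, so that the initial value of register `7` is never used. -/
theorem bestC_spec (hd : Describes n H adj inp) {s : St} (hs : Std n inp s) {u : ℕ}
    (hu : s.reg 6 = u) (hun : u < n) (hex : ∃ c < n, c ∉ H ∧ adj u c ∧ s.arr 4 c < n) :
    IsCheapest n H adj (s.arr 4) u ((bestC.den s).reg 7) ∧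
      (bestC.den s).reg 8 = s.arr 4 ((bestC.den s).reg 7) := by
  set b := block [headC 9, ifLt 0 12 skip (block [copy 10 6, copy 11 9,
    adjC, ifLt 0 12 (block [load 16 4 9, ifLt 16 8 (block [copy 8 16, copy 7 9]) skip]) skip])]
    with hb
  set s0 := (s.set 8 (s.reg 1)).set 7 0 with h0
  have hs0 : Std n inp s0 := (hs.set (by decide)).set (by decide)
  have e0 : bestC.den s = (loop 9 b).den s0 := rfl
  have key := loop_induction (x := 9) (p := b) (s := s0)
    (I := fun j s' => (∀ d < j, d ∉ H → adj u d → s'.reg 8 ≤ s.arr 4 d) ∧ s'.reg 8 ≤ n ∧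
      (s'.reg 8 < n → s'.reg 7 < n ∧ s'.reg 7 ∉ H ∧ adj u (s'.reg 7) ∧
        s.arr 4 (s'.reg 7) = s'.reg 8))
    (by simp [h0, hs.size]) (by
      intro j hj s' hf hx ⟨g1, g2, g3⟩
      have hs' : Std n inp s' := hs0.frame hf (by decide)
      have a4 : s'.arr 4 = s.arr 4 := hf.arr 4 (by decide)
      have u' : s'.reg 6 = u := (hf.reg 6 (by decide)).trans (by simp [h0, hu])
      rw [hs0.size] at hj
      set s1 := (headC 9).den s' with h1
      have hs1 : Std n inp s1 := hs'.den _ (by decide)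
      have hh : s1.reg 0 < s1.reg 12 ↔ j ∈ H := by
        rw [hs1.zero, ← hs'.zero]; exact headC_pos hd hs' hx hj
      have r1 : s1.reg 6 = u ∧ s1.reg 7 = s'.reg 7 ∧ s1.reg 8 = s'.reg 8 ∧ s1.reg 9 = j := by
        refine ⟨?_, ?_, ?_, ?_⟩ <;> rw [h1, den_reg (by decide)] <;> assumption
      set s2 := (s1.set 10 u).set 11 j with h2
      have hs2 : Std n inp s2 := (hs1.set (by decide)).set (by decide)
      set s3 := adjC.den s2 with h3
      have hs3 : Std n inp s3 := hs2.den _ (by decide)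
      have ha : s3.reg 0 < s3.reg 12 ↔ adj u j := by
        rw [hs3.zero, ← hs2.zero]
        exact adjC_pos hd hs2 (by simp [h2]) (by simp [h2]) hun hj
      have r3 : s3.reg 7 = s'.reg 7 ∧ s3.reg 8 = s'.reg 8 ∧ s3.reg 9 = j := by
        refine ⟨?_, ?_, ?_⟩ <;> rw [h3, den_reg (by decide), h2] <;> simp [r1]
      have a3 : s3.arr 4 = s.arr 4 := by
        rw [h3, den_arr (by decide), h2, St.set_arr, St.set_arr, h1, den_arr (by decide), a4]
      have e : b.den s' = if s1.reg 0 < s1.reg 12 then s1 else if s3.reg 0 < s3.reg 12 then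
          (if s.arr 4 j < s'.reg 8 then ((s3.set 16 (s.arr 4 j)).set 8 (s.arr 4 j)).set 7 j
            else s3.set 16 (s.arr 4 j)) else s3 := by
        simp [hb, block, Cmd.den, ← h1, r1, ← h2, ← h3, r3, a3]
      have split : ∀ {q : ℕ → Prop}, (∀ d < j, q d) → q j → ∀ d < j + 1, q d := by
        intro q hq hj d hd
        rcases Nat.lt_succ_iff_lt_or_eq.1 hd with hd | rfl
        · exact hq d hd
        · exact hj
      rw [e]
      by_cases hjH : j ∈ H
      · rw [if_pos (hh.2 hjH)]
        simp only [St.set_reg, r1]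
        exact ⟨split g1 fun h => absurd hjH h, g2, g3⟩
      · rw [if_neg (hh.not.2 hjH)]
        by_cases hadj : adj u j
        · rw [if_pos (ha.2 hadj)]
          by_cases hlt : s.arr 4 j < s'.reg 8
          · rw [if_pos hlt]
            simp only [St.set_reg]
            exact ⟨split (fun d hd h1 h2 => hlt.le.trans (g1 d hd h1 h2)) fun _ _ => le_rfl,
              hlt.le.trans g2, fun _ => ⟨hj, hjH, hadj, rfl⟩⟩
          · rw [if_neg hlt]
            simp only [St.set_reg, r3]
            exact ⟨split g1 fun _ _ => not_lt.1 hlt, g2, g3⟩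
        · rw [if_neg (ha.not.2 hadj)]
          simp only [St.set_reg, r3]
          exact ⟨split g1 fun _ h => absurd h hadj, g2, g3⟩)
  rw [hs0.size, ← e0] at key
  obtain ⟨k1, k2, k3⟩ := key
  obtain ⟨c, hc, hcH, hadj, hp⟩ := hex
  obtain ⟨q1, q2, q3, q4⟩ := k3 ((k1 c hc hcH hadj).trans_lt hp)
  exact ⟨⟨q1, q2, q3, q4 ▸ (k1 c hc hcH hadj).trans_lt hp, fun d hd h1 h2 => q4 ▸ k1 d hd h1 h2⟩,
    q4.symm⟩

theorem bidC_spec {s : St} (hs : Std n inp s) {u c : ℕ} (hu : s.reg 6 = u) (hc : s.reg 7 = c)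
    (hp : s.reg 8 = s.arr 4 c) :
    (bidC.den s).arr 5 = bidFlag (s.arr 5) (s.arr 3) u c ∧
    (bidC.den s).arr 3 = bidMate (s.arr 3) u c ∧
    (bidC.den s).arr 4 = Function.update (s.arr 4) c (s.arr 4 c + 1) := by
  by_cases h : 0 < s.arr 5 c <;>
    simp [bidC, block, Cmd.den, bidFlag, bidMate, hu, hc, hp, hs.zero, hs.one, h]

theorem turnC_spec (hd : Describes n H adj inp) (hM : Matchable n H adj) {s : St}
    (hs : Std n inp s) (ha : Auction n H adj (s.arr 5) (s.arr 3) (s.arr 4)) {u : ℕ}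
    (hu : s.reg 6 = u) (hun : u < n) :
    ((u ∈ H → 0 < s.arr 5 u) ∧ (turnC.den s).arr = s.arr) ∨
    (u ∈ H ∧ s.arr 5 u = 0 ∧
      Auction n H adj ((turnC.den s).arr 5) ((turnC.den s).arr 3) ((turnC.den s).arr 4) ∧
      totalPrice n H ((turnC.den s).arr 4) = totalPrice n H (s.arr 4) + 1) := by
  set s1 := (headC 6).den s with h1
  have hs1 : Std n inp s1 := hs.den _ (by decide)
  have hh : s1.reg 0 < s1.reg 12 ↔ u ∈ H := by
    rw [hs1.zero, ← hs.zero]; exact headC_pos hd hs hu hun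
  have a1 : s1.arr = s.arr := by rw [h1]; simp [headC, block, Cmd.den]
  have u1 : s1.reg 6 = u := by rw [h1, den_reg (by decide), hu]
  set s2 := s1.set 16 (s.arr 5 u) with h2
  have hs2 : Std n inp s2 := hs1.set (by decide)
  have a2 : s2.arr = s.arr := by rw [h2, St.set_arr, a1]
  set s3 := bestC.den s2 with h3
  have hs3 : Std n inp s3 := hs2.den _ (by decide)
  have a3 : s3.arr = s.arr := by
    rw [← a2]
    funext k
    exact den_arr (by simp [bestC, block, arrs, headC, adjC]) s2
  have e : turnC.den s = if s1.reg 0 < s1.reg 12 then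
      (if 0 < s.arr 5 u then s2 else bidC.den s3) else s1 := by
    have r2 : s2.reg 16 = s.arr 5 u := by simp [h2]
    simp [turnC, block, Cmd.den, ← h1, u1, a1, ← h2, ← h3, hs1.zero, hs2.zero, r2]
  rw [e]
  by_cases huH : u ∈ H
  · rw [if_pos (hh.2 huH)]
    by_cases hf : 0 < s.arr 5 u
    · left
      rw [if_pos hf]
      exact ⟨fun _ => hf, a2⟩
    · right
      rw [if_neg hf]
      have hf0 : s.arr 5 u = 0 := by omega
      obtain ⟨b1, b2⟩ := bestC_spec hd hs2 (by simp [h2, u1]) hun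
        (by rw [a2]; exact ha.exists_price_lt hM huH hf0)
      rw [← h3, a2] at b1 b2
      have u3 : s3.reg 6 = u := by
        rw [h3, den_reg (by decide)]; simp [h2, u1]
      obtain ⟨c1, c2, c3⟩ := bidC_spec hs3 u3 rfl (by rw [a3]; exact b2)
      rw [a3] at c1 c2 c3
      rw [c1, c2, c3]
      exact ⟨huH, hf0, ha.bid huH hf0 b1, totalPrice_bid b1⟩
  · left
    rw [if_neg (hh.not.2 huH)]
    exact ⟨fun h => absurd h huH, a1⟩

/-- All vertices of the head are matched, or the total price is at least `m`. -/
structure Advanced (n : ℕ) (H : Finset ℕ) (adj : ℕ → ℕ → Prop) (m : ℕ) (a : ℕ → ℕ → ℕ) : Prop where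
  auction : Auction n H adj (a 5) (a 3) (a 4)
  done : (∀ u ∈ H, 0 < a 5 u) ∨ m ≤ totalPrice n H (a 4)

/-- A sweep either contains a bid, which raises the total price, or meets every head vertex already
matched. Prices never fall, so a single bid settles the claim for the rest of the sweep. -/
theorem roundC_spec (hd : Describes n H adj inp) (hM : Matchable n H adj) {s : St}
    (hs : Std n inp s) {m : ℕ} (ha : Advanced n H adj m s.arr) :
    Advanced n H adj (m + 1) ((loop 6 turnC).den s).arr := by
  have key := loop_induction (x := 6) (p := turnC) (s := s)
    (I := fun j s' => Advanced n H adj m s'.arr ∧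
      ((∀ u ∈ H, u < j → 0 < s'.arr 5 u) ∨ m + 1 ≤ totalPrice n H (s'.arr 4)))
    ⟨ha, by simp⟩ (by
      intro j hj s' hf hx ⟨g1, g2⟩
      have hs' : Std n inp s' := hs.frame hf (by decide)
      rw [hs.size] at hj
      rw [St.set_arr]
      rcases turnC_spec hd hM hs' g1.auction hx hj with ⟨t1, t2⟩ | ⟨t1, t2, t3, t4⟩
      · rw [t2]
        refine ⟨g1, g2.imp_left fun g u hu huj => ?_⟩
        rcases Nat.lt_succ_iff_lt_or_eq.1 huj with huj | rfl
        · exact g u hu huj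
        · exact t1 hu
      -- A bid takes place, so `j` is unmatched and only the price alternative of `g1.done` is
      -- possible.
      · have : m ≤ totalPrice n H (s'.arr 4) := by
          rcases g1.done with g | g
          · have := g j t1
            omega
          · exact g
        exact ⟨⟨t3, Or.inr (by omega)⟩, Or.inr (by omega)⟩)
  rw [hs.size] at key
  refine ⟨key.1.auction, key.2.imp_left fun h u hu => h u hu (hd.lt hu)⟩

/-- After `n * n` sweeps the price alternative would contradict `Auction.totalPrice_lt`; if the head
is empty, there is nothing to match. -/
theorem matchC_spec (hd : Describes n H adj inp) (hM : Matchable n H adj)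
    (hcard : (Finset.range n \ H).card = H.card) {s : St} (hs : Std n inp s)
    (h5 : s.arr 5 = fun _ => 0) (h4 : s.arr 4 = fun _ => 0) :
    IsMate n H adj ((matchC.den s).arr 3) := by
  have key := loop_induction (x := 4) (p := loop 5 (loop 6 turnC)) (s := s)
    (I := fun i s' => Advanced n H adj (i * n) s'.arr)
    ⟨by rw [St.set_arr, h5, h4]; exact auction_init, by simp⟩ (by
      intro i hi s' hf hx h
      have hs' : Std n inp s' := hs.frame hf (by decide)
      have key := loop_induction (x := 5) (p := loop 6 turnC) (s := s')
        (I := fun j s' => Advanced n H adj (i * n + j) s'.arr) h (by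
          intro j hj s'' hf' hx' h'
          exact roundC_spec hd hM (hs'.frame hf' (by decide)) h')
      rw [hs'.size] at key
      rw [Nat.succ_mul]
      exact key)
  rw [hs.size] at key
  refine key.auction.isMate ?_ hcard
  rcases key.done with h | h
  · exact h
  · intro u hu
    exact absurd (key.auction.totalPrice_lt hu (hd.lt hu)) (not_lt.2 h)

end Specs

end EnumRAM
namespace EnumRAM

open Cmd

/-! ### The enumeration algorithm -/

/-- Deliver the current cover and go on to the next one. -/
def deliverC : Cmd := block [wordC, emit, nextC]

/-- Prepare the enumeration. -/
def setupC : Cmd := block [const 2 1, matchC, const 3 1]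

/-- The main loop. -/
def mainLoop : Prog := .whileLt 0 3 deliverC.compile

/-- The enumeration algorithm. -/
def enumProg : Prog :=
  .seq (.const 0 0) (.seq (.load 1 0 0) (.seq setupC.compile mainLoop))

/-- A bound for the number of steps between checkpoints. -/
noncomputable def checkpointTime : Polynomial ℕ := setupC.time + deliverC.time + 5

theorem natWord_injOn {n : ℕ} {S T : Finset ℕ} (hS : S ⊆ Finset.range n)
    (hT : T ⊆ Finset.range n) (h : natWord n S = natWord n T) : S = T := by
  have key : ∀ v < n, (v ∈ S ↔ v ∈ T) := by
    intro v hv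
    have := List.map_inj_left.1 h v (List.mem_range.2 hv)
    by_cases h1 : v ∈ S <;> by_cases h2 : v ∈ T <;> simp_all
  ext v
  exact ⟨fun h => (key v (Finset.mem_range.1 (hS h))).1 h,
    fun h => (key v (Finset.mem_range.1 (hT h))).2 h⟩

/-- The state `s` stands at the head of the main loop, with `A` the next set to be delivered. -/
structure Checkpoint (n : ℕ) (H : Finset ℕ) (adj : ℕ → ℕ → Prop) (inp mt : ℕ → ℕ)
    (A : Finset ℕ) (s : St) : Prop where
  std : Std n inp s
  mate : s.arr 3 = mt
  go : s.reg 3 = 1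
  buf : s.buf = []
  set : pos n (s.arr 1) = A
  closedIndep : ClosedIndep H (Forces H adj mt) adj A
  nodup : s.out.Nodup
  mem_out : ∀ w, w ∈ s.out ↔ ∃ D, ClosedIndep H (Forces H adj mt) adj D ∧
    toColex D < toColex A ∧ w = natWord n (coverOf n H mt D)

/-- The words have been delivered for all sets. -/
def Complete (n : ℕ) (H : Finset ℕ) (adj : ℕ → ℕ → Prop) (mt : ℕ → ℕ)
    (out : List (List ℕ)) : Prop :=
  out.Nodup ∧ ∀ w, w ∈ out ↔ ∃ D, ClosedIndep H (Forces H adj mt) adj D ∧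
    w = natWord n (coverOf n H mt D)

open Classical in
/-- The number of subsets of `H` after `A`. -/
noncomputable def remaining (H A : Finset ℕ) : ℕ :=
  (H.powerset.filter fun D => toColex A < toColex D).card

theorem remaining_lt {H A B : Finset ℕ} (hB : B ⊆ H) (hAB : toColex A < toColex B) :
    remaining H B < remaining H A := by
  refine Finset.card_lt_card (Finset.ssubset_iff_of_subset (fun D hD => ?_) |>.2 ⟨B, ?_, ?_⟩)
  · simp only [Finset.mem_filter] at hD ⊢
    exact ⟨hD.1, hAB.trans hD.2⟩
  · simpa using ⟨hB, hAB⟩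
  · simp

section Main

variable {n : ℕ} {H : Finset ℕ} {adj : ℕ → ℕ → Prop} {inp mt : ℕ → ℕ}

theorem coverOf_subset (A : Finset ℕ) : coverOf n H mt A ⊆ Finset.range n :=
  Finset.filter_subset _ _

/-- The output consists of the words of all closed independent sets before `A`. Delivering `A` adds
one new word, and since the successor is immediate, the same description holds at the next
checkpoint; without a successor the list is complete. -/
theorem Checkpoint.deliver (hd : Describes n H adj inp) (hm : IsMate n H adj mt) {A : Finset ℕ}
    {s : St} (h : Checkpoint n H adj inp mt A s) :
    s.out.length < (deliverC.den s).out.length ∧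
    ((∃ B, toColex A < toColex B ∧ Checkpoint n H adj inp mt B (deliverC.den s)) ∨
      ((deliverC.den s).reg 3 = 0 ∧ Complete n H adj mt (deliverC.den s).out)) := by
  set s1 := wordC.den s with h1
  set s2 : St := { s1 with buf := [], out := s1.out ++ [s1.buf] } with h2
  have e : deliverC.den s = nextC.den s2 := rfl
  have hs1 : Std n inp s1 := h.std.den _ (by decide)
  have hs2 : Std n inp s2 := ⟨hs1.zero, hs1.size, hs1.one, hs1.input⟩
  have m2 : s2.arr 3 = mt := by
    have : s2.arr 3 = s1.arr 3 := rfl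
    rw [this, h1, den_arr (by decide), h.mate]
  have A2 : pos n (s2.arr 1) = A := by
    have : s2.arr 1 = s1.arr 1 := rfl
    rw [this, h1, den_arr (by decide), h.set]
  have o2 : s2.out = s.out ++ [natWord n (coverOf n H mt A)] := by
    have hb := wordC_spec hd h.std (by rw [h.mate]; exact hm)
    rw [h.buf, h.mate, h.set, List.nil_append] at hb
    have : s2.out = s1.out ++ [s1.buf] := rfl
    rw [this, h1, hb, den_out (by decide)]
  have o3 : (nextC.den s2).out = s2.out := den_out (by decide) s2
  have nd : s2.out.Nodup := by
    rw [o2, List.nodup_append]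
    refine ⟨h.nodup, List.nodup_singleton _, ?_⟩
    rintro a ha b hb rfl
    obtain ⟨D, hD, hlt, hw⟩ := (h.mem_out a).1 ha
    rw [List.mem_singleton] at hb
    have := coverOf_injOn hd.subset h.closedIndep.subset hD.subset
      (natWord_injOn (coverOf_subset _) (coverOf_subset _) (hb.symm.trans hw))
    exact absurd hlt (this ▸ lt_irrefl _)
  have mem2 : ∀ w, w ∈ s2.out ↔ ∃ D, ClosedIndep H (Forces H adj mt) adj D ∧
      toColex D ≤ toColex A ∧ w = natWord n (coverOf n H mt D) := by
    intro w
    rw [o2, List.mem_append, List.mem_singleton, h.mem_out]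
    constructor
    · rintro (⟨D, h1, h2, h3⟩ | rfl)
      · exact ⟨D, h1, h2.le, h3⟩
      · exact ⟨A, h.closedIndep, le_rfl, rfl⟩
    · rintro ⟨D, h1, h2, h3⟩
      rcases h2.lt_or_eq with h2 | h2
      · exact Or.inl ⟨D, h1, h2, h3⟩
      · have : D = A := toColex_inj.1 h2
        exact Or.inr (this ▸ h3)
  have hE : ∀ u v, Forces H adj mt u v → v ∈ H := fun _ _ h => h.1
  have hcl : ∀ i ∈ H, IsClosureOf (Forces H adj mt) (raise A i) (candidate H adj mt A i) :=
    fun i _ => isClosureOf_leastClosed hE _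
  refine ⟨by rw [e, o3, o2]; simp, ?_⟩
  rw [e]
  rcases nextC_spec hd hs2 (by rw [m2]; exact hm) A2 with ⟨go, i, hadm, hmin, hset⟩ | ⟨go, hno⟩
  · left
    rw [m2] at hadm hmin hset
    have hi := hcl i hadm.mem
    have hlt := hadm.lt hi
    refine ⟨_, hlt, hs2.den _ (by decide), (den_arr (by decide) s2).trans m2, go,
      den_buf (by decide) s2, hset, hadm.closedIndep h.closedIndep hE hi, o3 ▸ nd, fun w => ?_⟩
    rw [o3, mem2]
    refine exists_congr fun D => and_congr_right fun hD => and_congr_left fun _ =>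
      ⟨fun hle => hle.trans_lt hlt, fun hDB => ?_⟩
    -- A set `D` strictly between `A` and its successor is excluded by `Admissible.le`.
    by_contra hAD
    exact absurd hDB (not_lt.2 (hadm.le hcl hmin hD (not_le.1 hAD)))
  · right
    rw [m2] at hno
    refine ⟨go, o3 ▸ nd, fun w => ?_⟩
    rw [o3, mem2]
    refine exists_congr fun D => and_congr_right fun hD =>
      ⟨fun h => h.2, fun hw => ⟨?_, hw⟩⟩
    by_contra hAD
    obtain ⟨w, -, -, hw⟩ := exists_admissible hD (not_le.1 hAD) _ hcl
    exact hno w hw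

theorem mainLoop_step {s : St} (h : s.reg 0 < s.reg 3) :
    step (s.cfg [mainLoop]) = s.cfg [deliverC.compile, mainLoop] := by
  simp [step, St.cfg, mainLoop, h]

theorem mainLoop_exit {s : St} (h : ¬ s.reg 0 < s.reg 3) : step (s.cfg [mainLoop]) = s.cfg [] := by
  simp [step, St.cfg, mainLoop, h]

theorem wf_deliverC : deliverC.WF := by
  constructor <;> decide

theorem wf_setupC : setupC.WF := by
  constructor <;> decide

theorem mainLoop_spec (hd : Describes n H adj inp) (hm : IsMate n H adj mt) {A : Finset ℕ}
    {s : St} (h : Checkpoint n H adj inp mt A s) :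
    (∃ T, (step^[T] (s.cfg [mainLoop])).Halted ∧
      Complete n H adj mt (step^[T] (s.cfg [mainLoop])).out) ∧
    ∀ t, Progress (2 * checkpointTime.eval n) (step^[t] (s.cfg [mainLoop])) := by
  -- The measure only serves termination: the checkpoints move strictly upwards among the finitely
  -- many subsets of the head. It may be exponentially large and does not enter the delay.
  refine progress_of_checkpoints (fun c => remaining H (pos n (c.arr 1)))
    (Inv := fun c => ∃ A s, c = s.cfg [mainLoop] ∧ Checkpoint n H adj inp mt A s) ?_ _
    ⟨A, s, rfl, h⟩
  rintro _ ⟨A, s, rfl, h⟩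
  obtain ⟨t, ht, hrun⟩ := compile_run wf_deliverC s
  rw [h.std.size] at ht
  have hT : t + 2 ≤ checkpointTime.eval n := by
    simp [checkpointTime]
    omega
  have hrun' : step^[t + 1] (s.cfg [mainLoop]) = (deliverC.den s).cfg [mainLoop] := by
    rw [Function.iterate_succ_apply, mainLoop_step (by rw [h.std.zero, h.go]; decide), hrun]
  obtain ⟨hout, ⟨B, hAB, hB⟩ | ⟨hgo, hcomp⟩⟩ := h.deliver hd hm
  · refine ⟨t + 1, by omega, ?_⟩
    rw [hrun']
    refine ⟨hout, Or.inl ⟨⟨B, _, rfl, hB⟩, ?_⟩⟩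
    change remaining H (pos n ((deliverC.den s).arr 1)) < remaining H (pos n (s.arr 1))
    rw [hB.set, h.set]
    exact remaining_lt hB.closedIndep.subset hAB
  · have hrun'' : step^[t + 1 + 1] (s.cfg [mainLoop]) = (deliverC.den s).cfg [] := by
      rw [Function.iterate_succ_apply', hrun', mainLoop_exit (by rw [hgo]; omega)]
    refine ⟨t + 1 + 1, by omega, ?_⟩
    rw [hrun'']
    exact ⟨hout, Or.inr ⟨rfl, hcomp⟩⟩

/-- One multiple of the checkpoint time covers the setup, and two more come from the main loop. -/
theorem enumProg_spec (w : List ℕ) (hd : Describes n H adj (fun i => w.getD i 0))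
    (hM : Matchable n H adj) (hcard : (Finset.range n \ H).card = H.card) :
    ∃ mt, IsMate n H adj mt ∧
      (∃ T, (run enumProg w T).Halted ∧ Complete n H adj mt (run enumProg w T).out) ∧
      HasDelay enumProg w (3 * checkpointTime.eval n) := by
  set inp : ℕ → ℕ := fun i => w.getD i 0 with hinp
  set s0 : St := ⟨fun r => if r = 1 then n else 0, (init enumProg w).arr, [], []⟩ with h0
  -- Three steps unfold `seq`; the other two clear register `0`, which held the length of the input
  -- word, and load `n` from cell `0` of the input into register `1`.
  have hstart : step^[5] (init enumProg w) = s0.cfg [setupC.compile, mainLoop] := by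
    have hreg : Function.update (Function.update (Function.update (fun _ => 0) 0 w.length) 0 0) 1
        n = fun r => if r = 1 then n else 0 := by
      funext r
      by_cases h1 : r = 1 <;> by_cases h0 : r = 0 <;> simp [h1, h0]
    have hn : w.getD 0 0 = n := hd.size
    rw [h0, ← hreg, ← hn]
    simp [Function.iterate_succ_apply, step, init, enumProg, St.cfg]
  obtain ⟨t, ht, hrun⟩ := compile_run wf_setupC s0
  have ht' : t + 5 ≤ checkpointTime.eval n := by
    have : s0.reg 1 = n := rfl
    rw [this] at ht
    simp [checkpointTime]
    omega
  set s := setupC.den s0 with hs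
  have hreach : run enumProg w (t + 5) = s.cfg [mainLoop] := by
    rw [run, Function.iterate_add_apply, hstart, hrun]
  set s1 := s0.set 2 1 with h1
  have e : s = (matchC.den s1).set 3 1 := rfl
  have hs1 : Std n inp s1 := by
    refine ⟨by simp [h1, h0], by simp [h1, h0], by simp [h1], ?_⟩
    simp [h1, h0, init, hinp]
  have a1 : ∀ k, k ≠ 0 → s1.arr k = fun _ => 0 := by
    intro k hk
    simp [h1, h0, init, hk]
  have hm := matchC_spec hd hM hcard hs1 (a1 5 (by decide)) (a1 4 (by decide))
  have hA : pos n (s.arr 1) = ∅ := by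
    rw [e, St.set_arr, den_arr (by decide), a1 1 (by decide)]
    simp [pos]
  have o : s.out = [] := by rw [e, St.set_out, den_out (by decide)]; rfl
  -- The empty set is closed, independent and first in the order, so the empty output is correct at
  -- this point.
  have hck : Checkpoint n H adj inp ((matchC.den s1).arr 3) ∅ s := by
    refine ⟨(hs1.den _ (by decide)).set (by decide), rfl, by simp [e], ?_, hA,
      ⟨by simp, by simp [ClosedUnder], by simp⟩, by simp [o], fun w => ?_⟩
    · rw [e, St.set_buf, den_buf (by decide)]; rfl
    · simp [o]
  obtain ⟨⟨T, hT, hcomp⟩, hdel⟩ := mainLoop_spec hd hm hck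
  have hadd : ∀ a, run enumProg w (a + (t + 5)) = step^[a] (s.cfg [mainLoop]) := by
    intro a
    rw [← hreach, run, Function.iterate_add_apply]
    rfl
  refine ⟨_, hm, ⟨T + (t + 5), by rwa [hadd], by rwa [hadd]⟩, fun a => ?_⟩
  have mono : Monotone fun a => (run enumProg w a).out.length := out_length_mono _
  have later : ∀ a, t + 5 ≤ a →
      (run enumProg w a).out.length <
        (run enumProg w (a + 2 * checkpointTime.eval n)).out.length ∨
      (run enumProg w (a + 2 * checkpointTime.eval n)).Halted := by
    intro a ha
    obtain ⟨b, rfl⟩ := Nat.exists_eq_add_of_le' ha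
    have := hdel b
    rw [Progress, ← Function.iterate_add_apply, ← hadd, ← hadd] at this
    rwa [show b + (t + 5) + 2 * checkpointTime.eval n =
      2 * checkpointTime.eval n + b + (t + 5) by ring]
  have hle : max a (t + 5) + 2 * checkpointTime.eval n ≤ a + 3 * checkpointTime.eval n := by
    omega
  rcases later (max a (t + 5)) (le_max_right _ _) with h | h
  · exact Or.inl ((mono (le_max_left _ _)).trans_lt (h.trans_le (mono hle)))
  · right
    have := halted_mono h hle
    rw [Cfg.Halted, run, this]
    exact h

end Main

end EnumRAM

/-! ### From instances of the problem to graphs on natural numbers -/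

namespace SmallCrown

open EnumRAM

/-- The head as a set of numbers. -/
def natHead (I : SmallCrown) : Finset ℕ := I.H.map Fin.valEmbedding

/-- The adjacency relation on numbers. -/
def natAdj (I : SmallCrown) (u v : ℕ) : Prop :=
  ∃ (hu : u < I.n) (hv : v < I.n), I.G.Adj ⟨u, hu⟩ ⟨v, hv⟩

theorem mem_natHead {I : SmallCrown} {v : Fin I.n} : (v : ℕ) ∈ I.natHead ↔ v ∈ I.H := by
  simp [natHead, Fin.val_inj]

theorem natAdj_iff {I : SmallCrown} {u v : Fin I.n} : I.natAdj u v ↔ I.G.Adj u v := by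
  simp [natAdj]

theorem natHead_subset (I : SmallCrown) : I.natHead ⊆ Finset.range I.n := by
  intro v hv
  obtain ⟨a, -, rfl⟩ := Finset.mem_map.1 hv
  exact Finset.mem_range.2 a.2

theorem describes (I : SmallCrown) :
    Describes I.n I.natHead I.natAdj (fun i => I.encode.getD i 0) := by
  classical
  have hlen : (charWord I.H).length = I.n := by simp [charWord]
  refine ⟨rfl, fun v hv => ?_, fun u hu v hv => ?_, I.natHead_subset⟩
  · have : I.encode.getD (v + 1) 0 = if (⟨v, hv⟩ : Fin I.n) ∈ I.H then 1 else 0 := by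
      simp only [encode, List.getD_cons_succ]
      rw [List.getD_append _ _ _ _ (by omega)]
      simp [charWord, List.getD_eq_getElem?_getD, hv]
    have hiff := mem_natHead (I := I) (v := ⟨v, hv⟩)
    rw [this]
    split_ifs with h
    · simpa using hiff.2 h
    · simpa using fun h' => h (hiff.1 h')
  · have hlt : u * I.n + v < I.n * I.n := by nlinarith
    -- The flattened matrix is indexed by `k = u * n + v`; quotient and remainder by `n` recover row
    -- and column.
    have hflat : (List.ofFn fun u : Fin I.n => List.ofFn fun v : Fin I.n =>
        if I.G.Adj u v then 1 else 0).flatten =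
        List.ofFn fun k : Fin (I.n * I.n) => if I.natAdj (k / I.n) (k % I.n) then 1 else 0 := by
      rw [List.ofFn_mul]
      congr 2
      funext a
      congr 1
      funext b
      have h1 : (a * I.n + b : ℕ) / I.n = a := by
        rw [mul_comm, Nat.mul_add_div (by omega), Nat.div_eq_of_lt b.2, add_zero]
      have h2 : (a * I.n + b : ℕ) % I.n = b := by
        rw [mul_comm, Nat.mul_add_mod, Nat.mod_eq_of_lt b.2]
      simp only [h1, h2, natAdj_iff]
    have : I.encode.getD (1 + I.n + u * I.n + v) 0 = if I.natAdj u v then 1 else 0 := by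
      simp only [encode]
      rw [show 1 + I.n + u * I.n + v = (I.n + (u * I.n + v)) + 1 by ring, List.getD_cons_succ,
        List.getD_append_right _ _ _ _ (by omega), hlen, Nat.add_sub_cancel_left, hflat]
      have h1 : (u * I.n + v : ℕ) / I.n = u := by
        rw [mul_comm, Nat.mul_add_div (by omega), Nat.div_eq_of_lt hv, add_zero]
      have h2 : (u * I.n + v : ℕ) % I.n = v := by
        rw [mul_comm, Nat.mul_add_mod, Nat.mod_eq_of_lt hv]
      simp [List.getD_eq_getElem?_getD, hlt, h1, h2]
    rw [this]
    split_ifs with h <;> simpa using h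

theorem card_sdiff_natHead (I : SmallCrown) :
    (Finset.range I.n \ I.natHead).card = I.natHead.card := by
  have h := I.isSmallCrowned.2
  rw [Finset.card_compl, Fintype.card_fin] at h
  rw [Finset.card_sdiff_of_subset I.natHead_subset, Finset.card_range, natHead, Finset.card_map, h]

/-- Every edge of `M` has an end in `H`, so sending a vertex to its edge maps the matched head
vertices onto the edges of `M`. There are `|H|` edges, hence every head vertex is matched. -/
theorem matchable (I : SmallCrown) : Matchable I.n I.natHead I.natAdj := by
  classical
  obtain ⟨M, hM, hbip, hcard⟩ := I.isSmallCrowned.1.2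
  have huniq : ∀ u v w, M.Adj u v → M.Adj u w → v = w := fun u v w h h' =>
    (hM h.fst_mem).unique h h'
  have hall : ∀ u ∈ I.H, ∃ v, M.Adj u v := by
    -- The value at unmatched vertices is a dummy; only the edges chosen at matched head vertices
    -- are counted.
    let f : Fin I.n → Sym2 (Fin I.n) := fun u =>
      if h : ∃ v, M.Adj u v then s(u, h.choose) else s(u, u)
    have hf : ∀ u v, M.Adj u v → f u = s(u, v) := by
      intro u v h
      have hex : ∃ v, M.Adj u v := ⟨v, h⟩
      simp only [f, dif_pos hex]
      rw [huniq u _ _ hex.choose_spec h]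
    have hsub : M.edgeSet ⊆ ((I.H.filter fun u => ∃ v, M.Adj u v).image f : Finset _) := by
      intro e he
      induction e with
      | _ a b =>
        have hab : M.Adj a b := he
        rw [Finset.coe_image]
        by_cases ha : a ∈ I.H
        · exact ⟨a, by simpa using ⟨ha, b, hab⟩, hf a b hab⟩
        · have hb : b ∈ I.H := by
            by_contra hb
            exact ha ((hbip a b hab).2 (Finset.mem_compl.2 hb))
          exact ⟨b, by simpa using ⟨hb, a, hab.symm⟩, (hf b a hab.symm).trans Sym2.eq_swap⟩
    have h1 := Set.ncard_le_ncard hsub (Finset.finite_toSet _)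
    rw [Set.ncard_coe_finset, hcard] at h1
    have h2 := Finset.eq_of_subset_of_card_le (Finset.filter_subset _ _)
      (h1.trans Finset.card_image_le)
    intro u hu
    rw [← h2] at hu
    exact (Finset.mem_filter.1 hu).2
  choose! m hm using hall
  refine ⟨fun u => if h : u < I.n then m ⟨u, h⟩ else 0, ?_, ?_⟩
  · intro a ha b hb hab
    obtain ⟨a, ha', rfl⟩ := Finset.mem_map.1 ha
    obtain ⟨b, hb', rfl⟩ := Finset.mem_map.1 hb
    simp only [Fin.valEmbedding_apply, a.2, b.2, dif_pos, Fin.val_inj] at hab ⊢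
    have h1 := hm a ha'
    have h2 := hm b hb'
    simp only [Fin.eta] at hab
    rw [hab] at h1
    exact huniq _ _ _ h1.symm h2.symm
  · intro u hu
    obtain ⟨a, ha, rfl⟩ := Finset.mem_map.1 hu
    simp only [Fin.valEmbedding_apply, a.2, dif_pos, Fin.eta, mem_natHead, natAdj_iff]
    have h1 := hm a ha
    exact ⟨(m a).2, Finset.mem_compl.1 ((hbip _ _ h1).1 ha), h1.adj_sub⟩

theorem charWord_eq {n : ℕ} (S : Finset (Fin n)) :
    charWord S = natWord n (S.map Fin.valEmbedding) := by
  refine List.ext_getElem (by simp [charWord, natWord]) fun i h1 h2 => ?_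
  have hi : i < n := by simpa [charWord] using h1
  have : i ∈ S.map Fin.valEmbedding ↔ (⟨i, hi⟩ : Fin n) ∈ S := by
    simp only [Finset.mem_map, Fin.valEmbedding_apply]
    exact ⟨fun ⟨a, ha, e⟩ => by subst e; exact ha, fun h => ⟨_, h, rfl⟩⟩
  simp [charWord, natWord, -Finset.mem_map, this]

/-- This is the correspondence between small covers and closed independent sets, carried over from
numbers to `Fin n`. The equivalence holds for every perfect matching `mt`, so it does not matter
which one the machine finds. -/
theorem mem_charWord_image (I : SmallCrown) {mt : ℕ → ℕ} (hm : IsMate I.n I.natHead I.natAdj mt)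
    (w : List ℕ) : w ∈ charWord '' I.Sol ↔
      ∃ D, ClosedIndep I.natHead (Forces I.natHead I.natAdj mt) I.natAdj D ∧
        w = natWord I.n (coverOf I.n I.natHead mt D) := by
  have hH : I.natHead.card = I.H.card := Finset.card_map _
  constructor
  · rintro ⟨S, ⟨hcov, hcard⟩, rfl⟩
    have hS : S.map Fin.valEmbedding ⊆ Finset.range I.n := by
      intro v hv
      obtain ⟨a, -, rfl⟩ := Finset.mem_map.1 hv
      exact Finset.mem_range.2 a.2
    obtain ⟨h1, h2⟩ := hm.exists_coverOf_eq I.natHead_subset hS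
      (by rw [Finset.card_map, hcard, hH]) (by
        rintro u _ v _ ⟨hu, hv, huv⟩
        exact (hcov huv).imp (fun h => Finset.mem_map_of_mem Fin.valEmbedding h)
          (fun h => Finset.mem_map_of_mem Fin.valEmbedding h))
    exact ⟨_, h1, by rw [h2, charWord_eq]⟩
  · rintro ⟨D, hD, rfl⟩
    set T := coverOf I.n I.natHead mt D with hT
    set S : Finset (Fin I.n) := Finset.univ.filter fun v => (v : ℕ) ∈ T with hSdef
    have hST : S.map Fin.valEmbedding = T := by
      ext v
      simp only [Finset.mem_map, hSdef, Finset.mem_filter, Finset.mem_univ, true_and,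
        Fin.valEmbedding_apply]
      constructor
      · rintro ⟨a, ha, rfl⟩
        exact ha
      · intro hv
        exact ⟨⟨v, Finset.mem_range.1 (coverOf_subset _ hv)⟩, hv, rfl⟩
    have hsymm : ∀ u v, I.natAdj u v → I.natAdj v u := fun u v ⟨hu, hv, h⟩ => ⟨hv, hu, h.symm⟩
    have hC : ∀ u v, I.natAdj u v → u ∈ I.natHead ∨ v ∈ I.natHead := by
      rintro u v ⟨hu, hv, h⟩
      by_contra! hcon
      have h1 : (⟨u, hu⟩ : Fin I.n) ∈ I.Hᶜ :=
        Finset.mem_compl.2 fun h => hcon.1 (mem_natHead.2 h)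
      have h2 : (⟨v, hv⟩ : Fin I.n) ∈ I.Hᶜ :=
        Finset.mem_compl.2 fun h => hcon.2 (mem_natHead.2 h)
      exact I.isSmallCrowned.1.1 h1 h2 h.ne h
    refine ⟨S, ⟨fun u v huv => ?_, ?_⟩, by rw [charWord_eq, hST]⟩
    · have := hm.coverOf_isCover hsymm hC hD u.2 v.2 (natAdj_iff.2 huv)
      simpa [hSdef] using this
    · rw [← Finset.card_map Fin.valEmbedding, hST, hT, hm.card_coverOf I.natHead_subset hD.subset,
        hH]

end SmallCrown

theorem mainTheorem3 :
    EnumRAM.AdmitsPolynomialDelay SmallCrown.size SmallCrown.encode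
      (fun I => SmallCrown.charWord '' I.Sol) := by
  refine ⟨EnumRAM.enumProg, 3 * EnumRAM.checkpointTime, fun I => ?_⟩
  obtain ⟨mt, hm, ⟨T, hT, hnodup, hmem⟩, hdel⟩ :=
    EnumRAM.enumProg_spec I.encode I.describes I.matchable I.card_sdiff_natHead
  refine ⟨⟨T, hT, hnodup, fun u => (hmem u).trans (I.mem_charWord_image hm u).symm⟩, fun t => ?_⟩
  -- The running time depends on the number of vertices only; polynomials with natural coefficients
  -- are monotone, so the edges can be added to the size.
  have hle : 3 * EnumRAM.checkpointTime.eval I.n ≤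
      (3 * EnumRAM.checkpointTime).eval I.size := by
    have := EnumRAM.eval_mono_nat EnumRAM.checkpointTime (Nat.le_add_right I.n I.G.edgeSet.ncard)
    simpa [SmallCrown.size] using this
  have hle' := Nat.add_le_add_left hle t
  rcases hdel t with h | h
  · exact Or.inl (h.trans_le (EnumRAM.out_length_mono _ hle'))
  · right
    rw [EnumRAM.Cfg.Halted, EnumRAM.run, EnumRAM.halted_mono h hle']
    exact h
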